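/- Consider the primal-dual pair of convex quadratic programs $$\text{(P)}\quad \min_x\ c^Tx+\tfrac12x^TQx\ \text{ s.t. } Ax=b,\ x\ge 0,\qquad \text{(D)}\quad \max_{x,y,z}\ b^Ty-\tfrac12x^TQx\ \text{ s.t. } -Qx+A^Ty+z=c,\ z\ge 0,$$ with $A\in\mathbb R^{m\times n}$, $1\le m\le n$, and $Q\in\mathbb R^{n\times n}$ symmetric positive semi-definite. A triple $(x,y,z)$ is called optimal if it satisfies the KKT conditions $c+Qx-A^Ty-z=0$, $Ax=b$, $x^iz^i=0$ for all $i$, and $(x,z)\ge 0$. *Algorithm IP-PMM.* The parameters are $0<\sigma_{\min}\le\sigma_{\max}\le\frac12$, $C_N>0$, $\gamma_{\mathcal A},\gamma_\mu\in(0,1)$, $\rho>0$. Put $(x_0,z_0)=\rho(e,e)$ with $e$ the vector of ones, let $y_0\in\mathbb R^m$ be given, and set $\mu_0=x_0^Tz_0/n$, $\bar b=Ax_0-b$, $\bar c=-Qx_0+A^Ty_0+z_0-c$, $\zeta_0=x_0$, $\lambda_0=y_0$. Let $\|(u,v)\|_{\mathcal A}=\min\{\|(x,z)\|_2: Ax=u,\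 -Qx+A^Ty+z=v \text{ for some } y\}$. For $t>0$ let $\mathcal N_t(\zeta,\lambda)$ be the set of all $(x,y,z)$ with $(x,z)>0$ and $x^iz^i\ge\gamma_\mu t$ for all $i$, such that $$Ax+t(y-\lambda)=b+\tfrac{t}{\mu_0}(\bar b+\tilde b),\qquad -Qx+A^Ty+z-t(x-\zeta)=c+\tfrac{t}{\mu_0}(\bar c+\tilde c)$$ for some $(\tilde b,\tilde c)$ with $\|(\tilde b,\tilde c)\|_2\le C_N$ and $\|(\tilde b,\tilde c)\|_{\mathcal A}\le\gamma_{\mathcal A}\rho$. In iteration $k\ge 0$, with $\mu_k=x_k^Tz_k/n$: 1. choose $\sigma_k\in[\sigma_{\min},\sigma_{\max}]$ and let $(\Delta x_k,\Delta y_k,\Delta z_k)$ solve $$\begin{aligned}-(Q+\mu_kI)\Delta x_k+A^T\Delta y_k+\Delta z_k&=c+\tfrac{\sigma_k\mu_k}{\mu_0}\bar c+Qx_k-A^Ty_k-z_k+\sigma_k\mu_k(x_k-\zeta_k),\\ A\Delta x_k+\mu_k\Delta y_k&=b+\tfrac{\sigma_k\mu_k}{\mu_0}\bar b-Ax_k-\sigma_k\mu_k(y_k-\lambda_k),\\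 z_k^i\Delta x_k^i+x_k^i\Delta z_k^i&=\sigma_k\mu_k-x_k^iz_k^i\quad(1\le i\le n);\end{aligned}$$ 2. let $\alpha_k$ be the largest $\alpha\in(0,1]$ with $\mu_k(\alpha)\le(1-0.01\alpha)\mu_k$ and $(x_k+\alpha\Delta x_k,\ y_k+\alpha\Delta y_k,\ z_k+\alpha\Delta z_k)\in\mathcal N_{\mu_k(\alpha)}(\zeta_k,\lambda_k)$, where $\mu_k(\alpha)=(x_k+\alpha\Delta x_k)^T(z_k+\alpha\Delta z_k)/n$, and let $(x_{k+1},y_{k+1},z_{k+1})$ be this point for $\alpha=\alpha_k$; 3. with $r_p=Ax_{k+1}-(b+\frac{\mu_{k+1}}{\mu_0}\bar b)$ and $r_d=-Qx_{k+1}+A^Ty_{k+1}+z_{k+1}-(c+\frac{\mu_{k+1}}{\mu_0}\bar c)$, set $(\zeta_{k+1},\lambda_{k+1})=(x_{k+1},y_{k+1})$ if $\|(r_p,r_d)\|_2\le C_N\frac{\mu_{k+1}}{\mu_0}$ and $\|(r_p,r_d)\|_{\mathcal A}\le\gamma_{\mathcal A}\rho\frac{\mu_{k+1}}{\mu_0}$,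 and $(\zeta_{k+1},\lambda_{k+1})=(\zeta_k,\lambda_k)$ otherwise. *Assumption 1.* There is an optimal triple $(x^*,y^*,z^*)$ with $\|x^*\|_\infty,\|y^*\|_\infty,\|z^*\|_\infty\le C^*$. *Assumption 2.* $\operatorname{rank}A=m$, the smallest singular value of $A$ is at least $C_A^1>0$, the largest is at most $C_A^2$, the largest eigenvalue of $Q$ is at most $C_Q$, and $\|(c,b)\|_\infty\le C_r$. **Theorem.** Given $1\le m\le n$, constants $C^*\ge 0$, $C_A^1,C_A^2,C_Q,C_r>0$, $C_y\ge 0$, $\rho>0$ and parameters $\sigma_{\min},\sigma_{\max},C_N,\gamma_{\mathcal A},\gamma_\mu$ as above, there is $q\in(0,1)$, depending only on these, such that for all problem data $(A,Q,b,c)$ that satisfy Assumptions 1 and 2 and every $y_0$ with $\|y_0\|_\infty\le C_y$ the following holds. (a) The algorithm is well defined: at every state that it reaches and for every $\sigma_k\in[\sigma_{\min},\sigma_{\max}]$, the Newton system has exactly one solution, and either the largest step-length in step 2 exists, or for some $\alpha\in(0,1]$ the point $(x_k+\alpha\Delta x_k,\ y_k+\alpha\Delta y_k,\ z_k+\alpha\Delta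 z_k)$ is an optimal triple of (P)-(D). (b) For every infinite sequence of iterates that the algorithm generates, $\mu_k\to0$ $Q$-linearly: $\mu_{k+1}\le q\,\mu_k$ for all $k$. (c) For each such sequence, the regularized residual norms $$\Big\|Ax_k+\mu_k(y_k-\lambda_k)-b-\tfrac{\mu_k}{\mu_0}\bar b\Big\|_2\quad\text{and}\quad\Big\|-Qx_k+A^Ty_k+z_k-\mu_k(x_k-\zeta_k)-c-\tfrac{\mu_k}{\mu_0}\bar c\Big\|_2$$ converge $R$-linearly to zero: each of them is dominated by a sequence that converges $Q$-linearly to zero with factor $q$. -/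

import Mathlib

open Filter Topology Matrix

noncomputable section

namespace IPPMM

/-- Data of the convex quadratic programming pair
`min cᵀx + ½ xᵀQx  s.t.  Ax = b, x ≥ 0` and
`max bᵀy - ½ xᵀQx  s.t.  -Qx + Aᵀy + z = c, z ≥ 0`. -/
structure QP (n m : ℕ) where
  A : Matrix (Fin m) (Fin n) ℝ
  Q : Matrix (Fin n) (Fin n) ℝ
  b : Fin m → ℝ
  c : Fin n → ℝ
  Q_psd : Q.PosSemidef

/-- A primal-dual triple `w = (x, y, z)`. -/
structure Triple (n m : ℕ) where
  x : Fin n → ℝ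
  y : Fin m → ℝ
  z : Fin n → ℝ

/-- The Euclidean norm. -/
def norm2 {ι : Type} [Fintype ι] (v : ι → ℝ) : ℝ :=
  ‖(WithLp.toLp 2 v : EuclideanSpace ℝ ι)‖

/-- The Euclidean norm of the stacked vector `(u, v)`. -/
def pairNorm2 {ι κ : Type} [Fintype ι] [Fintype κ] (u : ι → ℝ) (v : κ → ℝ) : ℝ :=
  norm2 (Sum.elim u v)

/-- `Q`-linear convergence of `u` to `L` with factor `q`. -/
def ConvergesQLinearly (q : ℝ) (u : ℕ → ℝ) (L : ℝ) : Prop :=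
  0 < q ∧ q < 1 ∧ Tendsto u atTop (𝓝 L) ∧ ∀ k, |u (k + 1) - L| ≤ q * |u k - L|

/-- `R`-linear convergence of `u` to `L` with factor `q`: the error is dominated by a sequence
that converges `Q`-linearly to zero with factor `q`. -/
def ConvergesRLinearly (q : ℝ) (u : ℕ → ℝ) (L : ℝ) : Prop :=
  ∃ v : ℕ → ℝ, ConvergesQLinearly q v 0 ∧ ∀ k, |u k - L| ≤ v k

variable {n m : ℕ}

/-- The complementarity measure `xᵀz / n`. -/
def mu (w : Triple n m) : ℝ := (w.x ⬝ᵥ w.z) / n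

/-- The point `w + α Δw`. -/
def Triple.move (w : Triple n m) (α : ℝ) (d : Triple n m) : Triple n m where
  x := w.x + α • d.x
  y := w.y + α • d.y
  z := w.z + α • d.z

namespace QP

/-- An optimal primal-dual triple: a solution of the KKT system
`c + Qx - Aᵀy - z = 0`, `Ax - b = 0`, `XZe = 0`, `(x, z) ≥ 0`. -/
def IsOptimalTriple (P : QP n m) (w : Triple n m) : Prop :=
  P.c + P.Q *ᵥ w.x - P.Aᵀ *ᵥ w.y - w.z = 0 ∧
  P.A *ᵥ w.x - P.b = 0 ∧
  (∀ i, w.x i * w.z i = 0) ∧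
  (∀ i, 0 ≤ w.x i) ∧ (∀ i, 0 ≤ w.z i)

/-- The largest singular value of `A`. -/
def etaMax (P : QP n m) : ℝ := (Matrix.toEuclideanLin P.A).singularValues 0

/-- The smallest of the `min m n` singular values of `A` (Mathlib lists them in decreasing order,
starting with index `0`). -/
def etaMin (P : QP n m) : ℝ := (Matrix.toEuclideanLin P.A).singularValues (min m n - 1)

/-- The largest eigenvalue of `Q`. -/
def nuMax (P : QP n m) : ℝ := ⨆ i, P.Q_psd.isHermitian.eigenvalues i

/-- First assumption: there is an optimal triple whose entries are bounded by `Cstar`. -/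
def Assumption1 (P : QP n m) (Cstar : ℝ) : Prop :=
  ∃ w : Triple n m, P.IsOptimalTriple w ∧ ‖w.x‖ ≤ Cstar ∧ ‖w.y‖ ≤ Cstar ∧ ‖w.z‖ ≤ Cstar

/-- Second assumption: full row rank and bounds on the data. The norm of the stacked vector
`(c, b)` is the maximum norm. -/
def Assumption2 (P : QP n m) (CA1 CA2 CQ Cr : ℝ) : Prop :=
  P.A.rank = m ∧ CA1 ≤ P.etaMin ∧ P.etaMax ≤ CA2 ∧ P.nuMax ≤ CQ ∧ ‖Sum.elim P.c P.b‖ ≤ Cr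

/-- The semi-norm
`‖(b, c)‖_𝒜 = min { ‖(x, z)‖₂ : Ax = b, -Qx + Aᵀy + z = c }`
(the feasible set is nonempty and the minimum is attained when `A` has full row rank). -/
def seminormA (P : QP n m) (b : Fin m → ℝ) (c : Fin n → ℝ) : ℝ :=
  sInf {r | ∃ w : Triple n m, P.A *ᵥ w.x = b ∧ -(P.Q *ᵥ w.x) + P.Aᵀ *ᵥ w.y + w.z = c ∧
    r = pairNorm2 w.x w.z}

end QP

/-- The parameters of the algorithm. -/
structure Params where
  sigmaMin : ℝ
  sigmaMax : ℝ
  CN : ℝ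
  gammaA : ℝ
  gammaMu : ℝ
  sigmaMin_pos : 0 < sigmaMin
  sigmaMin_le : sigmaMin ≤ sigmaMax
  sigmaMax_le : sigmaMax ≤ 1 / 2
  CN_pos : 0 < CN
  gammaA_pos : 0 < gammaA
  gammaA_lt : gammaA < 1
  gammaMu_pos : 0 < gammaMu
  gammaMu_lt : gammaMu < 1

/-- The starting triple `(x₀, y₀, z₀) = (ρ e, y₀, ρ e)`. -/
def startTriple (n : ℕ) (rho : ℝ) (y0 : Fin m → ℝ) : Triple n m where
  x := fun _ => rho
  y := y0
  z := fun _ => rho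

/-- An instance of the algorithm: a problem, the parameters, and the starting point. -/
structure Setup (n m : ℕ) where
  P : QP n m
  par : Params
  rho : ℝ
  y0 : Fin m → ℝ

/-- The state of the algorithm at the start of an iteration: the iterate `(x, y, z)` and the
proximal estimates `ζ`, `λ`. -/
structure State (n m : ℕ) where
  w : Triple n m
  zeta : Fin n → ℝ
  lam : Fin m → ℝ

namespace Setup

/-- The starting triple. -/
def w0 (S : Setup n m) : Triple n m := startTriple n S.rho S.y0

/-- `μ₀ = x₀ᵀz₀ / n`. -/
def mu0 (S : Setup n m) : ℝ := mu S.w0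

/-- The initial primal infeasibility `b̄ = A x₀ - b`. -/
def bbar (S : Setup n m) : Fin m → ℝ := S.P.A *ᵥ S.w0.x - S.P.b

/-- The initial dual infeasibility `c̄ = -Q x₀ + Aᵀ y₀ + z₀ - c`. -/
def cbar (S : Setup n m) : Fin n → ℝ :=
  -(S.P.Q *ᵥ S.w0.x) + S.P.Aᵀ *ᵥ S.w0.y + S.w0.z - S.P.c

/-- The initial state, with `ζ₀ = x₀` and `λ₀ = y₀`. -/
def start (S : Setup n m) : State n m where
  w := S.w0
  zeta := S.w0.x
  lam := S.w0.y

/-- `A x + t (y - λ) - b - (t / μ₀) b̄`. -/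
def primalResidual (S : Setup n m) (t : ℝ) (lam : Fin m → ℝ) (w : Triple n m) : Fin m → ℝ :=
  S.P.A *ᵥ w.x + t • (w.y - lam) - S.P.b - (t / S.mu0) • S.bbar

/-- `-Q x + Aᵀ y + z - t (x - ζ) - c - (t / μ₀) c̄`. -/
def dualResidual (S : Setup n m) (t : ℝ) (zeta : Fin n → ℝ) (w : Triple n m) : Fin n → ℝ :=
  -(S.P.Q *ᵥ w.x) + S.P.Aᵀ *ᵥ w.y + w.z - t • (w.x - zeta) - S.P.c - (t / S.mu0) • S.cbar

/-- The enlarged set `𝒞̃_t(ζ, λ)`. -/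
def enlargedSet (S : Setup n m) (t : ℝ) (zeta : Fin n → ℝ) (lam : Fin m → ℝ) :
    Set (Triple n m) :=
  {w | ∃ (bt : Fin m → ℝ) (ct : Fin n → ℝ),
    S.P.A *ᵥ w.x + t • (w.y - lam) = S.P.b + (t / S.mu0) • (S.bbar + bt) ∧
    -(S.P.Q *ᵥ w.x) + S.P.Aᵀ *ᵥ w.y + w.z - t • (w.x - zeta)
      = S.P.c + (t / S.mu0) • (S.cbar + ct) ∧
    pairNorm2 bt ct ≤ S.par.CN ∧
    S.P.seminormA bt ct ≤ S.par.gammaA * S.rho}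

/-- The neighbourhood `𝒩_t(ζ, λ)`. -/
def neighbourhood (S : Setup n m) (t : ℝ) (zeta : Fin n → ℝ) (lam : Fin m → ℝ) :
    Set (Triple n m) :=
  {w | w ∈ S.enlargedSet t zeta lam ∧ (∀ i, 0 < w.x i) ∧ (∀ i, 0 < w.z i) ∧
    ∀ i, S.par.gammaMu * t ≤ w.x i * w.z i}

/-- `d = (Δx, Δy, Δz)` solves the perturbed Newton system at the state `s` with centering
parameter `σ`. -/
def IsNewtonDirection (S : Setup n m) (s : State n m) (σ : ℝ) (d : Triple n m) : Prop :=
  -((S.P.Q + mu s.w • (1 : Matrix (Fin n) (Fin n) ℝ)) *ᵥ d.x) + S.P.Aᵀ *ᵥ d.y + d.z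
    = -(-(S.P.c + (σ * mu s.w / S.mu0) • S.cbar) - S.P.Q *ᵥ s.w.x + S.P.Aᵀ *ᵥ s.w.y + s.w.z
        - (σ * mu s.w) • (s.w.x - s.zeta)) ∧
  S.P.A *ᵥ d.x + mu s.w • d.y
    = -(S.P.A *ᵥ s.w.x + (σ * mu s.w) • (s.w.y - s.lam)
        - (S.P.b + (σ * mu s.w / S.mu0) • S.bbar)) ∧
  ∀ i, s.w.z i * d.x i + s.w.x i * d.z i = -(s.w.x i * s.w.z i - σ * mu s.w)

/-- The step-lengths `α ∈ (0, 1]` that satisfy the decrease condition and keep the new triple in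
the neighbourhood. -/
def admissibleSteps (S : Setup n m) (s : State n m) (d : Triple n m) : Set ℝ :=
  {α | 0 < α ∧ α ≤ 1 ∧
    mu (s.w.move α d) ≤ (1 - 0.01 * α) * mu s.w ∧
    s.w.move α d ∈ S.neighbourhood (mu (s.w.move α d)) s.zeta s.lam}

/-- `r_p = A x - (b + (μ / μ₀) b̄)`, where `μ = xᵀz / n`. -/
def rp (S : Setup n m) (w : Triple n m) : Fin m → ℝ :=
  S.P.A *ᵥ w.x - (S.P.b + (mu w / S.mu0) • S.bbar)

/-- `r_d = -Q x + Aᵀ y + z - (c + (μ / μ₀) c̄)`, where `μ = xᵀz / n`. -/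
def rd (S : Setup n m) (w : Triple n m) : Fin n → ℝ :=
  -(S.P.Q *ᵥ w.x) + S.P.Aᵀ *ᵥ w.y + w.z - (S.P.c + (mu w / S.mu0) • S.cbar)

/-- The test under which the proximal estimates are replaced by the new iterate `w`. The sign of
`r_d` is that of the dual equation in the neighbourhood, so the test says that the infeasibility
bounds of the neighbourhood hold at `w` with the new estimates `ζ = x`, `λ = y`. -/
def UpdateTest (S : Setup n m) (w : Triple n m) : Prop :=
  pairNorm2 (S.rp w) (S.rd w) ≤ S.par.CN * (mu w / S.mu0) ∧
    S.P.seminormA (S.rp w) (S.rd w) ≤ S.par.gammaA * S.rho * (mu w / S.mu0)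

/-- One iteration of the algorithm takes the state `s` to the state `s'`. -/
def Step (S : Setup n m) (s s' : State n m) : Prop :=
  ∃ σ ∈ Set.Icc S.par.sigmaMin S.par.sigmaMax, ∃ d, S.IsNewtonDirection s σ d ∧
    ∃ α, IsGreatest (S.admissibleSteps s d) α ∧
      s'.w = s.w.move α d ∧
      ((S.UpdateTest s'.w ∧ s'.zeta = s'.w.x ∧ s'.lam = s'.w.y) ∨
        (¬ S.UpdateTest s'.w ∧ s'.zeta = s.zeta ∧ s'.lam = s.lam))

/-- The states that the algorithm can reach after finitely many iterations. -/
def Reachable (S : Setup n m) (s : State n m) : Prop :=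
  Relation.ReflTransGen S.Step S.start s

/-- A sequence of states generated by the algorithm (run without a stopping tolerance). -/
def IsRun (S : Setup n m) (s : ℕ → State n m) : Prop :=
  s 0 = S.start ∧ ∀ k, S.Step (s k) (s (k + 1))

end Setup

end IPPMM

end

namespace LinearMap

variable {E F : Type*} [NormedAddCommGroup E] [InnerProductSpace ℝ E] [FiniteDimensional ℝ E]
  [NormedAddCommGroup F] [InnerProductSpace ℝ F] [FiniteDimensional ℝ F] (T : E →ₗ[ℝ] F)

theorem norm_sq_apply_eq_sum_singularValues {n : ℕ} (hn : Module.finrank ℝ E = n) (v : E) :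
    ‖T v‖ ^ 2 = ∑ i : Fin n, T.singularValues i ^ 2 *
      (T.isSymmetric_adjoint_comp_self.eigenvectorBasis hn).repr v i ^ 2 := by
  set e := T.isSymmetric_adjoint_comp_self.eigenvectorBasis hn with he
  have h1 : ‖T v‖ ^ 2 = inner ℝ v ((adjoint T ∘ₗ T) v) := by
    rw [comp_apply, adjoint_inner_right, real_inner_self_eq_norm_sq]
  rw [h1, ← e.repr.inner_map_map, PiLp.inner_apply]
  refine Finset.sum_congr rfl fun i _ => ?_
  have h2 := T.isSymmetric_adjoint_comp_self.eigenvectorBasis_apply_self_apply hn v i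
  rw [← he] at h2
  rw [h2, ← T.sq_singularValues_fin hn i]
  simp only [RCLike.inner_apply, conj_trivial, RCLike.ofReal_real_eq_id, _root_.id]
  ring

theorem norm_apply_le_singularValues_zero (v : E) : ‖T v‖ ≤ T.singularValues 0 * ‖v‖ := by
  have h0 := T.singularValues_nonneg 0
  refine le_of_sq_le_sq ?_ (by positivity)
  rw [T.norm_sq_apply_eq_sum_singularValues rfl, mul_pow,
    ← (T.isSymmetric_adjoint_comp_self.eigenvectorBasis rfl).repr.norm_map v,
    EuclideanSpace.real_norm_sq_eq, Finset.mul_sum]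
  refine Finset.sum_le_sum fun i _ => mul_le_mul_of_nonneg_right ?_ (sq_nonneg _)
  exact pow_le_pow_left₀ (T.singularValues_nonneg _) (T.singularValues_antitone (Nat.zero_le _)) 2

/-- If the first `finrank F` singular values are at least `c > 0`, then `T` has a right inverse
of norm at most `1 / c`. -/
theorem exists_apply_eq_of_le_singularValues {c : ℝ} (hc : 0 < c)
    (hle : Module.finrank ℝ F ≤ Module.finrank ℝ E)
    (h : c ≤ T.singularValues (Module.finrank ℝ F - 1)) (y : F) :
    ∃ v, T v = y ∧ c * ‖v‖ ≤ ‖y‖ := by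
  set k := Module.finrank ℝ F with hk
  set e := T.isSymmetric_adjoint_comp_self.eigenvectorBasis rfl with he
  let ext : (Fin k → ℝ) →ₗ[ℝ] (Fin (Module.finrank ℝ E) → ℝ) :=
    { toFun := fun a i => if hi : i.1 < k then a ⟨i, hi⟩ else 0
      map_add' := fun a b => by ext i; by_cases hi : i.1 < k <;> simp [hi]
      map_smul' := fun r a => by ext i; by_cases hi : i.1 < k <;> simp [hi] }
  let V : (Fin k → ℝ) →ₗ[ℝ] E :=
    e.repr.symm.toLinearEquiv.toLinearMap ∘ₗ
      (WithLp.linearEquiv 2 ℝ (Fin (Module.finrank ℝ E) → ℝ)).symm.toLinearMap ∘ₗ ext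
  have hV : ∀ a i, e.repr (V a) i = if hi : i.1 < k then a ⟨i, hi⟩ else 0 := by
    intro a i
    simp [V, ext]
  have hlow : ∀ a, c * ‖V a‖ ≤ ‖T (V a)‖ := by
    intro a
    refine le_of_sq_le_sq ?_ (norm_nonneg _)
    rw [T.norm_sq_apply_eq_sum_singularValues rfl, mul_pow, ← e.repr.norm_map,
      EuclideanSpace.real_norm_sq_eq, Finset.mul_sum]
    refine Finset.sum_le_sum fun i _ => ?_
    by_cases hi : i.1 < k
    · refine mul_le_mul_of_nonneg_right (pow_le_pow_left₀ hc.le (h.trans ?_) 2) (sq_nonneg _)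
      exact T.singularValues_antitone (by omega)
    · have := hV a i
      rw [dif_neg hi] at this
      rw [← he, this]; simp
  have hinj : Function.Injective (T ∘ₗ V) := by
    rw [← ker_eq_bot, ker_eq_bot']
    intro a ha
    have h1 := hlow a
    rw [show T (V a) = 0 from ha, norm_zero] at h1
    have h2 : V a = 0 := norm_le_zero_iff.1 (by nlinarith [norm_nonneg (V a)])
    ext i
    have h3 := hV a ⟨i, i.2.trans_le hle⟩
    rw [h2, map_zero] at h3
    simpa using h3.symm
  have hsurj : Function.Surjective (T ∘ₗ V) :=
    (injective_iff_surjective_of_finrank_eq_finrank (by simp [hk])).1 hinj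
  obtain ⟨a, rfl⟩ := hsurj y
  exact ⟨V a, rfl, hlow a⟩

end LinearMap

namespace Matrix

variable {ι κ : Type*} [Fintype ι] [Fintype κ]

theorem abs_dotProduct_le (u v : ι → ℝ) : |u ⬝ᵥ v| ≤ Fintype.card ι * (‖u‖ * ‖v‖) := by
  refine (Finset.abs_sum_le_sum_abs _ _).trans ?_
  refine (Finset.sum_le_card_nsmul _ _ (‖u‖ * ‖v‖) fun i _ => ?_).trans (by simp)
  rw [abs_mul]
  exact mul_le_mul (norm_le_pi_norm u i) (norm_le_pi_norm v i) (abs_nonneg _) (norm_nonneg _)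

theorem dotProduct_self_nonneg_real (v : ι → ℝ) : 0 ≤ v ⬝ᵥ v :=
  Finset.sum_nonneg fun i _ => mul_self_nonneg (v i)

theorem sq_norm_le_dotProduct_self (v : ι → ℝ) : ‖v‖ ^ 2 ≤ v ⬝ᵥ v := by
  refine (Real.le_sqrt (norm_nonneg _) (dotProduct_self_nonneg_real v)).1 ?_
  refine (pi_norm_le_iff_of_nonneg (Real.sqrt_nonneg _)).2 fun i => Real.abs_le_sqrt ?_
  rw [sq]
  exact Finset.single_le_sum (f := fun i => v i * v i) (fun j _ => mul_self_nonneg (v j))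
    (Finset.mem_univ i)

theorem norm_transpose_mulVec_le {A : Matrix κ ι ℝ} {K : ℝ} (hK : 0 ≤ K)
    (h : ∀ x, ‖A *ᵥ x‖ ≤ K * ‖x‖) (y : κ → ℝ) :
    ‖Aᵀ *ᵥ y‖ ≤ Fintype.card κ * K * ‖y‖ := by
  set w := Aᵀ *ᵥ y with hw
  have h2 : ‖w‖ * ‖w‖ ≤ Fintype.card κ * K * ‖y‖ * ‖w‖ := by
    calc ‖w‖ * ‖w‖ = ‖w‖ ^ 2 := (sq _).symm
      _ ≤ w ⬝ᵥ w := sq_norm_le_dotProduct_self w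
      _ = (A *ᵥ w) ⬝ᵥ y := (dotProduct_transpose_mulVec A w y).trans (dotProduct_comm _ _)
      _ ≤ Fintype.card κ * (‖A *ᵥ w‖ * ‖y‖) := (le_abs_self _).trans (abs_dotProduct_le _ _)
      _ ≤ Fintype.card κ * (K * ‖w‖ * ‖y‖) := by gcongr; exact h w
      _ = _ := by ring
  rcases (norm_nonneg w).eq_or_lt with h0 | h0
  · rw [← h0]; positivity
  · exact le_of_mul_le_mul_right h2 h0

theorem norm_le_norm_transpose_mulVec {A : Matrix κ ι ℝ} {K : ℝ} (hK : 0 ≤ K)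
    (h : ∀ u, ∃ v, A *ᵥ v = u ∧ ‖v‖ ≤ K * ‖u‖) (y : κ → ℝ) :
    ‖y‖ ≤ Fintype.card ι * K * ‖Aᵀ *ᵥ y‖ := by
  obtain ⟨v, hv, hvn⟩ := h y
  have h2 : ‖y‖ * ‖y‖ ≤ Fintype.card ι * K * ‖Aᵀ *ᵥ y‖ * ‖y‖ := by
    calc ‖y‖ * ‖y‖ = ‖y‖ ^ 2 := (sq _).symm
      _ ≤ y ⬝ᵥ y := sq_norm_le_dotProduct_self y
      _ = v ⬝ᵥ (Aᵀ *ᵥ y) := by rw [dotProduct_transpose_mulVec, hv]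
      _ ≤ Fintype.card ι * (‖v‖ * ‖Aᵀ *ᵥ y‖) := (le_abs_self _).trans (abs_dotProduct_le _ _)
      _ ≤ Fintype.card ι * (K * ‖y‖ * ‖Aᵀ *ᵥ y‖) := by gcongr
      _ = _ := by ring
  rcases (norm_nonneg y).eq_or_lt with h0 | h0
  · rw [← h0]; positivity
  · exact le_of_mul_le_mul_right h2 h0

theorem IsHermitian.norm_toEuclideanLin_le [DecidableEq ι] {Q : Matrix ι ι ℝ} (hQ : Q.IsHermitian)
    {c : ℝ} (hc : 0 ≤ c) (h : ∀ i, |hQ.eigenvalues i| ≤ c) (v : EuclideanSpace ℝ ι) :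
    ‖toEuclideanLin Q v‖ ≤ c * ‖v‖ := by
  have hs : (toEuclideanLin Q).IsSymmetric := isSymmetric_toEuclideanLin_iff.2 hQ
  have he : ∀ i, toEuclideanLin Q (hQ.eigenvectorBasis i) =
      hQ.eigenvalues i • hQ.eigenvectorBasis i := by
    intro i
    rw [toLpLin_apply, hQ.mulVec_eigenvectorBasis]
    rfl
  have hr : ∀ i, hQ.eigenvectorBasis.repr (toEuclideanLin Q v) i =
      hQ.eigenvalues i * hQ.eigenvectorBasis.repr v i := by
    intro i
    rw [OrthonormalBasis.repr_apply_apply, OrthonormalBasis.repr_apply_apply, ← hs, he,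
      real_inner_smul_left]
  refine le_of_sq_le_sq ?_ (by positivity)
  rw [mul_pow, ← hQ.eigenvectorBasis.repr.norm_map, ← hQ.eigenvectorBasis.repr.norm_map v,
    EuclideanSpace.real_norm_sq_eq, EuclideanSpace.real_norm_sq_eq, Finset.mul_sum]
  refine Finset.sum_le_sum fun i _ => ?_
  rw [hr, mul_pow]
  exact mul_le_mul_of_nonneg_right (sq_le_sq' (by linarith [neg_abs_le (hQ.eigenvalues i), h i])
    ((le_abs_self _).trans (h i))) (sq_nonneg _)

end Matrix

namespace IPPMM

variable {ι κ : Type} [Fintype ι] [Fintype κ]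

theorem norm2_nonneg (v : ι → ℝ) : 0 ≤ norm2 v := norm_nonneg _

theorem norm2_sq (v : ι → ℝ) : norm2 v ^ 2 = ∑ i, v i ^ 2 := by
  rw [norm2, EuclideanSpace.real_norm_sq_eq]

theorem norm_le_norm2 (v : ι → ℝ) : ‖v‖ ≤ norm2 v := by
  refine le_of_sq_le_sq ?_ (norm2_nonneg v)
  rw [norm2_sq]
  exact (sq_norm_le_dotProduct_self v).trans_eq (by simp [dotProduct, sq])

theorem norm2_le (v : ι → ℝ) : norm2 v ≤ Fintype.card ι * ‖v‖ := by
  refine le_of_sq_le_sq ?_ (by positivity)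
  rw [norm2_sq]
  have h1 : ∑ i, v i ^ 2 ≤ Fintype.card ι * ‖v‖ ^ 2 := by
    refine (Finset.sum_le_card_nsmul _ _ (‖v‖ ^ 2) fun i _ => ?_).trans (by simp)
    rw [← sq_abs]
    exact pow_le_pow_left₀ (abs_nonneg _) (norm_le_pi_norm v i) 2
  have h2 : (Fintype.card ι : ℝ) ≤ (Fintype.card ι : ℝ) ^ 2 := by
    exact_mod_cast Nat.le_self_pow two_ne_zero _
  rw [mul_pow]
  exact h1.trans (mul_le_mul_of_nonneg_right h2 (sq_nonneg _))

theorem norm2_add_le (u v : ι → ℝ) : norm2 (u + v) ≤ norm2 u + norm2 v := by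
  simpa [norm2] using norm_add_le (WithLp.toLp 2 u) (WithLp.toLp 2 v)

theorem norm2_smul (r : ℝ) (v : ι → ℝ) : norm2 (r • v) = |r| * norm2 v := by
  simp [norm2, norm_smul]

theorem continuous_norm2 : Continuous (norm2 : (ι → ℝ) → ℝ) :=
  continuous_norm.comp (PiLp.continuous_toLp 2 _)

theorem pairNorm2_nonneg (u : ι → ℝ) (v : κ → ℝ) : 0 ≤ pairNorm2 u v := norm2_nonneg _

theorem pairNorm2_add_le (u u' : ι → ℝ) (v v' : κ → ℝ) :
    pairNorm2 (u + u') (v + v') ≤ pairNorm2 u v + pairNorm2 u' v' := by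
  unfold pairNorm2
  rw [show Sum.elim (u + u') (v + v') = Sum.elim u v + Sum.elim u' v' by
    ext i; cases i <;> rfl]
  exact norm2_add_le _ _

theorem pairNorm2_smul (r : ℝ) (u : ι → ℝ) (v : κ → ℝ) :
    pairNorm2 (r • u) (r • v) = |r| * pairNorm2 u v := by
  unfold pairNorm2
  rw [show Sum.elim (r • u) (r • v) = r • Sum.elim u v by ext i; cases i <;> rfl]
  exact norm2_smul _ _

theorem norm2_le_pairNorm2_left (u : ι → ℝ) (v : κ → ℝ) : norm2 u ≤ pairNorm2 u v := by
  refine le_of_sq_le_sq ?_ (pairNorm2_nonneg u v)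
  rw [pairNorm2, norm2_sq, norm2_sq, Fintype.sum_sum_type]
  simpa using Finset.sum_nonneg fun i _ => sq_nonneg (v i)

theorem norm2_le_pairNorm2_right (u : ι → ℝ) (v : κ → ℝ) : norm2 v ≤ pairNorm2 u v := by
  refine le_of_sq_le_sq ?_ (pairNorm2_nonneg u v)
  rw [pairNorm2, norm2_sq, norm2_sq, Fintype.sum_sum_type]
  simpa using Finset.sum_nonneg fun i _ => sq_nonneg (u i)

theorem norm_left_le_pairNorm2 (u : ι → ℝ) (v : κ → ℝ) : ‖u‖ ≤ pairNorm2 u v :=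
  (norm_le_norm2 u).trans (norm2_le_pairNorm2_left u v)

theorem norm_right_le_pairNorm2 (u : ι → ℝ) (v : κ → ℝ) : ‖v‖ ≤ pairNorm2 u v :=
  (norm_le_norm2 v).trans (norm2_le_pairNorm2_right u v)

theorem pairNorm2_le {u : ι → ℝ} {v : κ → ℝ} {r : ℝ} (hr : 0 ≤ r) (hu : ‖u‖ ≤ r) (hv : ‖v‖ ≤ r) :
    pairNorm2 u v ≤ (Fintype.card ι + Fintype.card κ) * r := by
  refine (norm2_le _).trans ?_
  rw [Fintype.card_sum, Nat.cast_add]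
  gcongr
  rw [pi_norm_le_iff_of_nonneg hr]
  rintro (i | i)
  · exact (norm_le_pi_norm u i).trans hu
  · exact (norm_le_pi_norm v i).trans hv

theorem continuous_pairNorm2 :
    Continuous fun p : (ι → ℝ) × (κ → ℝ) => pairNorm2 p.1 p.2 := by
  refine continuous_norm2.comp (continuous_pi ?_)
  rintro (i | i)
  · exact (continuous_apply i).comp continuous_fst
  · exact (continuous_apply i).comp continuous_snd

variable {n m : ℕ}

/-- Quantitative regularity of the problem data, in the maximum norm: the matrices are bounded,
`A` has a bounded right inverse and `Aᵀ` is bounded below, and there is a bounded optimal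
triple. -/
structure QP.Bounded (P : QP n m) (K : ℝ) : Prop where
  A_le : ∀ x, ‖P.A *ᵥ x‖ ≤ K * ‖x‖
  At_le : ∀ y, ‖P.Aᵀ *ᵥ y‖ ≤ K * ‖y‖
  Q_le : ∀ x, ‖P.Q *ᵥ x‖ ≤ K * ‖x‖
  right_inv : ∀ u, ∃ v, P.A *ᵥ v = u ∧ ‖v‖ ≤ K * ‖u‖
  le_At : ∀ y, ‖y‖ ≤ K * ‖P.Aᵀ *ᵥ y‖
  b_le : ‖P.b‖ ≤ K
  c_le : ‖P.c‖ ≤ K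
  optimal : ∃ w : Triple n m, P.IsOptimalTriple w ∧ ‖w.x‖ ≤ K ∧ ‖w.y‖ ≤ K ∧ ‖w.z‖ ≤ K

theorem QP.Bounded.mono {P : QP n m} {K K' : ℝ} (h : P.Bounded K) (hK : K ≤ K') :
    P.Bounded K' := by
  obtain ⟨w, hw, hx, hy, hz⟩ := h.optimal
  refine ⟨fun x => (h.A_le x).trans ?_, fun y => (h.At_le y).trans ?_,
    fun x => (h.Q_le x).trans ?_, fun u => ?_, fun y => (h.le_At y).trans ?_, h.b_le.trans hK,
    h.c_le.trans hK, w, hw, hx.trans hK, hy.trans hK, hz.trans hK⟩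
  all_goals try exact mul_le_mul_of_nonneg_right hK (norm_nonneg _)
  obtain ⟨v, hv, hvn⟩ := h.right_inv u
  exact ⟨v, hv, hvn.trans (mul_le_mul_of_nonneg_right hK (norm_nonneg _))⟩

theorem QP.norm_A_mulVec_le {P : QP n m} {c : ℝ} (hc : 0 ≤ c) (h : P.etaMax ≤ c) (x : Fin n → ℝ) :
    ‖P.A *ᵥ x‖ ≤ c * n * ‖x‖ := by
  have h1 : norm2 (P.A *ᵥ x) ≤ c * norm2 x := by
    have h2 := (toEuclideanLin P.A).norm_apply_le_singularValues_zero (WithLp.toLp 2 x)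
    rw [toLpLin_toLp] at h2
    exact h2.trans (mul_le_mul_of_nonneg_right h (norm_nonneg _))
  refine (norm_le_norm2 _).trans (h1.trans ?_)
  rw [mul_assoc]
  exact mul_le_mul_of_nonneg_left (by simpa using norm2_le x) hc

theorem QP.exists_A_mulVec_eq {P : QP n m} (hmn : m ≤ n) {c : ℝ} (hc : 0 < c) (h : c ≤ P.etaMin)
    (u : Fin m → ℝ) : ∃ v, P.A *ᵥ v = u ∧ ‖v‖ ≤ m / c * ‖u‖ := by
  obtain ⟨v, hv, hvn⟩ := (toEuclideanLin P.A).exists_apply_eq_of_le_singularValues hc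
    (by simpa using hmn) (by simpa [QP.etaMin, min_eq_left hmn] using h) (WithLp.toLp 2 u)
  refine ⟨v.ofLp, ?_, ?_⟩
  · have := congrArg WithLp.ofLp hv
    simpa [toLpLin_apply] using this
  · have h1 : ‖v.ofLp‖ ≤ ‖v‖ := norm_le_norm2 v.ofLp
    have h2 : norm2 u ≤ m * ‖u‖ := by simpa using norm2_le u
    rw [div_mul_eq_mul_div, le_div_iff₀ hc]
    have h3 : c * ‖v‖ ≤ norm2 u := hvn
    nlinarith

theorem QP.norm_Q_mulVec_le {P : QP n m} {c : ℝ} (hc : 0 ≤ c) (h : P.nuMax ≤ c) (x : Fin n → ℝ) :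
    ‖P.Q *ᵥ x‖ ≤ c * n * ‖x‖ := by
  have h1 : norm2 (P.Q *ᵥ x) ≤ c * norm2 x := by
    have h2 := P.Q_psd.isHermitian.norm_toEuclideanLin_le hc (fun i => ?_) (WithLp.toLp 2 x)
    · rwa [toLpLin_toLp] at h2
    · rw [abs_of_nonneg (P.Q_psd.eigenvalues_nonneg i)]
      exact (le_ciSup (Set.finite_range _).bddAbove i).trans h
  refine (norm_le_norm2 _).trans (h1.trans ?_)
  rw [mul_assoc]
  exact mul_le_mul_of_nonneg_left (by simpa using norm2_le x) hc

/-- The data bounds of the two assumptions yield uniform regularity. -/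
theorem QP.exists_bounded (hmn : m ≤ n) {Cstar CA1 CA2 CQ : ℝ} (Cr : ℝ) (hCA1 : 0 < CA1)
    (hCA2 : 0 ≤ CA2) (hCQ : 0 ≤ CQ) :
    ∃ K, ∀ P : QP n m, P.Assumption1 Cstar → P.Assumption2 CA1 CA2 CQ Cr → P.Bounded K := by
  set K₁ := CA2 * n
  set K₂ : ℝ := m / CA1
  have hK₁ : 0 ≤ K₁ := by positivity
  have hK₂ : 0 ≤ K₂ := by positivity
  have hK₃ : 0 ≤ CQ * n := by positivity
  have hm : 0 ≤ (m : ℝ) * K₁ := by positivity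
  have hn : 0 ≤ (n : ℝ) * K₂ := by positivity
  refine ⟨K₁ + K₂ + CQ * n + m * K₁ + n * K₂ + |Cr| + |Cstar|, ?_⟩
  have hr := le_abs_self Cr
  have hs := le_abs_self Cstar
  have hr0 := abs_nonneg Cr
  have hs0 := abs_nonneg Cstar
  rintro P ⟨w, hw, hx, hy, hz⟩ ⟨-, h1, h2, h3, h4⟩
  have hA := fun x => P.norm_A_mulVec_le hCA2 h2 x
  have hR := fun u => QP.exists_A_mulVec_eq hmn hCA1 h1 u
  have hAt := fun y => norm_transpose_mulVec_le hK₁ hA y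
  have hinv := fun y => norm_le_norm_transpose_mulVec hK₂ hR y
  simp only [Fintype.card_fin] at hAt hinv
  have hbc := (pi_norm_le_iff_of_nonneg ((norm_nonneg _).trans h4)).1 h4
  refine ⟨fun x => (hA x).trans ?_, fun y => (hAt y).trans ?_,
    fun x => (P.norm_Q_mulVec_le hCQ h3 x).trans ?_, fun u => ?_, fun y => (hinv y).trans ?_,
    ?_, ?_, w, hw, by linarith, by linarith, by linarith⟩
  · exact mul_le_mul_of_nonneg_right (by linarith) (norm_nonneg _)
  · exact mul_le_mul_of_nonneg_right (by linarith) (norm_nonneg _)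
  · exact mul_le_mul_of_nonneg_right (by linarith) (norm_nonneg _)
  · obtain ⟨v, hv, hvn⟩ := hR u
    exact ⟨v, hv, hvn.trans (mul_le_mul_of_nonneg_right (by linarith) (norm_nonneg _))⟩
  · exact mul_le_mul_of_nonneg_right (by linarith) (norm_nonneg _)
  · refine (pi_norm_le_iff_of_nonneg (by linarith)).2 fun i => ?_
    have := hbc (Sum.inr i)
    simp only [Sum.elim_inr] at this
    linarith
  · refine (pi_norm_le_iff_of_nonneg (by linarith)).2 fun i => ?_
    have := hbc (Sum.inl i)
    simp only [Sum.elim_inl] at this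
    linarith

end IPPMM

namespace IPPMM

variable {n m : ℕ}

namespace QP

variable {P : QP n m} {K : ℝ}

theorem Bounded.nonneg (hP : P.Bounded K) : 0 ≤ K := (norm_nonneg _).trans hP.b_le

theorem seminormA_le {b : Fin m → ℝ} {c : Fin n → ℝ} (w : Triple n m) (h1 : P.A *ᵥ w.x = b)
    (h2 : -(P.Q *ᵥ w.x) + P.Aᵀ *ᵥ w.y + w.z = c) : P.seminormA b c ≤ pairNorm2 w.x w.z :=
  csInf_le ⟨0, fun _ ⟨_, _, _, h⟩ => h ▸ pairNorm2_nonneg _ _⟩ ⟨w, h1, h2, rfl⟩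

/-- A solution of the equations in the definition of the semi-norm, of size comparable to the
right-hand side. -/
theorem Bounded.exists_feasible (hP : P.Bounded K) (b : Fin m → ℝ) (c : Fin n → ℝ) :
    ∃ w : Triple n m, P.A *ᵥ w.x = b ∧ -(P.Q *ᵥ w.x) + P.Aᵀ *ᵥ w.y + w.z = c ∧
      ‖w.x‖ ≤ K * ‖b‖ ∧ ‖w.z‖ ≤ ‖c‖ + K * (K * ‖b‖) := by
  obtain ⟨v, hv, hvn⟩ := hP.right_inv b
  refine ⟨⟨v, 0, c + P.Q *ᵥ v⟩, hv, by simp, hvn, ?_⟩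
  refine (norm_add_le _ _).trans (add_le_add_right ((hP.Q_le v).trans ?_) _)
  exact mul_le_mul_of_nonneg_left hvn hP.nonneg

theorem Bounded.exists_lt (hP : P.Bounded K) {b : Fin m → ℝ} {c : Fin n → ℝ} {r : ℝ}
    (h : P.seminormA b c < r) :
    ∃ w : Triple n m, P.A *ᵥ w.x = b ∧ -(P.Q *ᵥ w.x) + P.Aᵀ *ᵥ w.y + w.z = c ∧
      pairNorm2 w.x w.z < r := by
  obtain ⟨w, h1, h2, -⟩ := hP.exists_feasible b c
  obtain ⟨_, ⟨w, h1, h2, rfl⟩, hr⟩ := exists_lt_of_csInf_lt (by exact ⟨_, w, h1, h2, rfl⟩) h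
  exact ⟨w, h1, h2, hr⟩

theorem Bounded.seminormA_add_le (hP : P.Bounded K) (b b' : Fin m → ℝ) (c c' : Fin n → ℝ) :
    P.seminormA (b + b') (c + c') ≤ P.seminormA b c + P.seminormA b' c' := by
  refine le_of_forall_pos_lt_add fun ε hε => ?_
  obtain ⟨w, h1, h2, h3⟩ := hP.exists_lt (lt_add_of_pos_right (P.seminormA b c) (half_pos hε))
  obtain ⟨w', h1', h2', h3'⟩ :=
    hP.exists_lt (lt_add_of_pos_right (P.seminormA b' c') (half_pos hε))
  refine (P.seminormA_le ⟨w.x + w'.x, w.y + w'.y, w.z + w'.z⟩ ?_ ?_).trans_lt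
    ((pairNorm2_add_le _ _ _ _).trans_lt ?_)
  · simp only [mulVec_add, h1, h1']
  · simp only [mulVec_add, ← h2, ← h2']
    abel
  · linarith

theorem Bounded.seminormA_smul_le (hP : P.Bounded K) {r : ℝ} (hr : 0 ≤ r) (b : Fin m → ℝ)
    (c : Fin n → ℝ) : P.seminormA (r • b) (r • c) ≤ r * P.seminormA b c := by
  refine le_of_forall_pos_lt_add fun ε hε => ?_
  obtain ⟨w, h1, h2, h3⟩ :=
    hP.exists_lt (lt_add_of_pos_right (P.seminormA b c) (show 0 < ε / (r + 1) by positivity))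
  refine (P.seminormA_le ⟨r • w.x, r • w.y, r • w.z⟩ ?_ ?_).trans_lt
    ((pairNorm2_smul _ _ _).trans_lt ?_)
  · simp only [mulVec_smul, h1]
  · simp only [mulVec_smul, ← h2, smul_add, smul_neg]
  · rw [abs_of_nonneg hr]
    have h4 : r * (ε / (r + 1)) < ε := by
      rw [mul_div_assoc', div_lt_iff₀ (by linarith)]
      nlinarith
    nlinarith

theorem Bounded.seminormA_le_of_norm_le (hP : P.Bounded K) {b : Fin m → ℝ} {c : Fin n → ℝ}
    {r : ℝ} (hb : ‖b‖ ≤ r) (hc : ‖c‖ ≤ r) :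
    P.seminormA b c ≤ 2 * n * (1 + K + K * K) * r := by
  have hK := hP.nonneg
  have hr : 0 ≤ r := (norm_nonneg _).trans hb
  obtain ⟨w, h1, h2, h3, h4⟩ := hP.exists_feasible b c
  have h5 : K * ‖b‖ ≤ K * r := mul_le_mul_of_nonneg_left hb hK
  have h6 : K * (K * ‖b‖) ≤ K * (K * r) := mul_le_mul_of_nonneg_left h5 hK
  have h7 : 0 ≤ K * r := by positivity
  have h8 : 0 ≤ K * (K * r) := by positivity
  refine (P.seminormA_le w h1 h2).trans ((pairNorm2_le (r := (1 + K + K * K) * r) (by positivity)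
    ?_ ?_).trans_eq ?_)
  · linarith
  · linarith
  · simp only [Fintype.card_fin]; ring

end QP

namespace Setup

variable {S : Setup n m}

/-- The regularized residuals at `w` satisfy the infeasibility bounds of the neighbourhood. -/
def ResidualBound (S : Setup n m) (t : ℝ) (zeta : Fin n → ℝ) (lam : Fin m → ℝ)
    (w : Triple n m) : Prop :=
  pairNorm2 (S.primalResidual t lam w) (S.dualResidual t zeta w) ≤ S.par.CN * (t / S.mu0) ∧
  S.P.seminormA (S.primalResidual t lam w) (S.dualResidual t zeta w) ≤
    S.par.gammaA * S.rho * (t / S.mu0)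

theorem mem_enlargedSet_iff {K : ℝ} (hP : S.P.Bounded K) {t : ℝ} (ht : 0 < t) (h0 : 0 < S.mu0)
    {zeta : Fin n → ℝ} {lam : Fin m → ℝ} {w : Triple n m} :
    w ∈ S.enlargedSet t zeta lam ↔ S.ResidualBound t zeta lam w := by
  have hτ : 0 < t / S.mu0 := div_pos ht h0
  constructor
  · rintro ⟨bt, ct, h1, h2, h3, h4⟩
    have hp : S.primalResidual t lam w = (t / S.mu0) • bt := by
      rw [primalResidual, h1, smul_add]; abel
    have hd : S.dualResidual t zeta w = (t / S.mu0) • ct := by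
      rw [dualResidual, h2, smul_add]; abel
    rw [ResidualBound, hp, hd, pairNorm2_smul, abs_of_pos hτ]
    refine ⟨by nlinarith, (hP.seminormA_smul_le hτ.le _ _).trans (by nlinarith)⟩
  · rintro ⟨h1, h2⟩
    refine ⟨(t / S.mu0)⁻¹ • S.primalResidual t lam w, (t / S.mu0)⁻¹ • S.dualResidual t zeta w,
      ?_, ?_, ?_, ?_⟩
    · rw [smul_add, smul_inv_smul₀ hτ.ne', primalResidual]; abel
    · rw [smul_add, smul_inv_smul₀ hτ.ne', dualResidual]; abel
    · rw [pairNorm2_smul, abs_of_pos (inv_pos.2 hτ), inv_mul_le_iff₀ hτ]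
      linarith
    · refine (hP.seminormA_smul_le (inv_pos.2 hτ).le _ _).trans ?_
      rw [inv_mul_le_iff₀ hτ]
      linarith

theorem updateTest_iff {w : Triple n m} :
    S.UpdateTest w ↔ S.ResidualBound (mu w) w.x w.y w := by
  have hp : S.primalResidual (mu w) w.y w = S.rp w := by
    rw [primalResidual, rp, sub_self, smul_zero, add_zero, sub_sub]
  have hd : S.dualResidual (mu w) w.x w = S.rd w := by
    rw [dualResidual, rd, sub_self, smul_zero, sub_zero, sub_sub]
  rw [UpdateTest, ResidualBound, hp, hd]

/-- Quantitative regularity of an instance of the algorithm with given parameters. -/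
structure Bounded (S : Setup n m) (par : Params) (rho K : ℝ) : Prop where
  P : S.P.Bounded K
  par_eq : S.par = par
  rho_eq : S.rho = rho
  y0_le : ‖S.y0‖ ≤ K

theorem mu0_eq (hn : 0 < n) (S : Setup n m) : S.mu0 = S.rho ^ 2 := by
  have : (n : ℝ) ≠ 0 := by positivity
  simp only [mu0, mu, w0, startTriple, dotProduct, Finset.sum_const, Finset.card_univ,
    Fintype.card_fin, nsmul_eq_mul]
  field_simp

theorem Bounded.norm_bbar_le {par : Params} {rho K : ℝ} (hS : S.Bounded par rho K)
    (hrho : 0 ≤ rho) : ‖S.bbar‖ ≤ K * rho + K := by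
  refine (norm_sub_le _ _).trans (add_le_add ((hS.P.A_le _).trans ?_) hS.P.b_le)
  refine mul_le_mul_of_nonneg_left ?_ hS.P.nonneg
  refine (pi_norm_le_iff_of_nonneg hrho).2 fun i => ?_
  simp [w0, startTriple, hS.rho_eq, abs_of_nonneg hrho]

theorem Bounded.norm_cbar_le {par : Params} {rho K : ℝ} (hS : S.Bounded par rho K)
    (hrho : 0 ≤ rho) : ‖S.cbar‖ ≤ K * rho + K * K + rho + K := by
  have hx : ‖S.w0.x‖ ≤ rho := by
    refine (pi_norm_le_iff_of_nonneg hrho).2 fun i => ?_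
    simp [w0, startTriple, hS.rho_eq, abs_of_nonneg hrho]
  refine (norm_sub_le _ _).trans (add_le_add ((norm_add_le _ _).trans (add_le_add
    ((norm_add_le _ _).trans (add_le_add ?_ ?_)) hx)) hS.P.c_le)
  · rw [norm_neg]
    exact (hS.P.Q_le _).trans (mul_le_mul_of_nonneg_left hx hS.P.nonneg)
  · exact (hS.P.At_le _).trans (mul_le_mul_of_nonneg_left hS.y0_le hS.P.nonneg)

end Setup

end IPPMM

namespace IPPMM

variable {n m : ℕ}

theorem QP.le_dotProduct_of_eq {P : QP n m} {hx hz q : Fin n → ℝ} {hy p : Fin m → ℝ}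
    (h1 : P.A *ᵥ hx = p) (h2 : -(P.Q *ᵥ hx) + P.Aᵀ *ᵥ hy + hz = q) :
    hx ⬝ᵥ q - hy ⬝ᵥ p ≤ hx ⬝ᵥ hz := by
  have h3 := P.Q_psd.dotProduct_mulVec_nonneg hx
  simp only [star_trivial] at h3
  rw [← h2, dotProduct_add, dotProduct_add, dotProduct_neg, dotProduct_transpose_mulVec, h1]
  linarith

theorem dotProduct_polarization {ι : Type*} [Fintype ι] (a b c : ι → ℝ) :
    (c - b) ⬝ᵥ (c - b) - (c - a) ⬝ᵥ (c - a) ≤ -(2 * ((b - a) ⬝ᵥ (c - b))) := by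
  have h := dotProduct_self_nonneg_real (b - a)
  have h1 : c - a = (b - a) + (c - b) := by abel
  rw [h1, dotProduct_add, add_dotProduct, add_dotProduct, dotProduct_comm (c - b) (b - a)]
  linarith

theorem QP.proximal_inequality {P : QP n m} {x X z Z zeta : Fin n → ℝ} {y Y lam : Fin m → ℝ}
    {t : ℝ} (ht : 0 ≤ t) (h1 : P.A *ᵥ (X - x) = t • (y - lam))
    (h2 : -(P.Q *ᵥ (X - x)) + P.Aᵀ *ᵥ (Y - y) + (Z - z) = -(t • (x - zeta))) :
    t / 2 * ((Y - y) ⬝ᵥ (Y - y) + (X - x) ⬝ᵥ (X - x) - (Y - lam) ⬝ᵥ (Y - lam)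
      - (X - zeta) ⬝ᵥ (X - zeta)) ≤ (X - x) ⬝ᵥ (Z - z) := by
  refine le_trans ?_ (QP.le_dotProduct_of_eq h1 h2)
  rw [dotProduct_neg, dotProduct_smul, dotProduct_smul, dotProduct_comm (X - x) (x - zeta),
    dotProduct_comm (Y - y) (y - lam), smul_eq_mul, smul_eq_mul]
  have h3 := dotProduct_polarization lam y Y
  have h4 := dotProduct_polarization zeta x X
  nlinarith

theorem mul_convexCombination_le {τ ρ K p r a b : ℝ} (hρ : 0 < ρ) (hτ : 0 < τ) (hτ1 : τ ≤ 1)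
    (hp1 : p ≤ 2 * (τ * ρ)) (hr : 0 ≤ r) (hr1 : r ≤ 2 * (τ * ρ)) (ha : 0 ≤ a)
    (haK : a ≤ K) (hb : 0 ≤ b) (hbK : b ≤ K) (hab : a * b = 0) :
    (p + (1 - τ) * a) * (r + (1 - τ) * b) ≤ τ * (4 * ρ ^ 2 + 4 * ρ * K) := by
  have h0 : 0 < τ * ρ := mul_pos hτ hρ
  have h1 : τ * ρ ≤ ρ := mul_le_of_le_one_left hρ.le hτ1
  have h2 : (1 - τ) * a ≤ K := (mul_le_of_le_one_left ha (by linarith)).trans haK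
  have h3 : (1 - τ) * b ≤ K := (mul_le_of_le_one_left hb (by linarith)).trans hbK
  have h4 : 0 ≤ (1 - τ) * a := mul_nonneg (by linarith) ha
  have h5 : 0 ≤ (1 - τ) * b := mul_nonneg (by linarith) hb
  have h6 : p * r ≤ 2 * (τ * ρ) * (2 * ρ) := mul_le_mul hp1 (by linarith) hr (by linarith)
  have h7 : p * ((1 - τ) * b) ≤ 2 * (τ * ρ) * K := mul_le_mul hp1 h3 h5 (by linarith)
  have h8 : r * ((1 - τ) * a) ≤ 2 * (τ * ρ) * K := mul_le_mul hr1 h2 h4 (by linarith)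
  have h9 : (p + (1 - τ) * a) * (r + (1 - τ) * b) = p * r + p * ((1 - τ) * b) +
      r * ((1 - τ) * a) + (1 - τ) ^ 2 * (a * b) := by ring
  rw [h9, hab]
  linarith

namespace Setup

variable {par : Params} {rho K : ℝ}

theorem norm_w0_x_le (S : Setup n m) (h : 0 ≤ S.rho) : ‖S.w0.x‖ ≤ S.rho :=
  (pi_norm_le_iff_of_nonneg h).2 fun i => by simp [w0, startTriple, abs_of_nonneg h]

set_option maxHeartbeats 400000 in
/-- For `t ≤ μ₀`, the perturbed system solved by a point satisfying the residual bounds also has a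
uniformly bounded solution whose `x` and `z` parts are at least a multiple of `t` and nearly
complementary. -/
theorem exists_comparison (par : Params) (hrho : 0 < rho) (K : ℝ) :
    ∃ C, 0 ≤ C ∧ ∀ S : Setup n m, S.Bounded par rho K → ∀ t zeta lam w, 0 < t → t ≤ S.mu0 →
      0 < S.mu0 → S.ResidualBound t zeta lam w → ∃ W : Triple n m,
        S.P.A *ᵥ (W.x - w.x) = t • (w.y - lam) ∧
        -(S.P.Q *ᵥ (W.x - w.x)) + S.P.Aᵀ *ᵥ (W.y - w.y) + (W.z - w.z) = -(t • (w.x - zeta)) ∧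
        (∀ i, t / S.mu0 * (rho * (1 - par.gammaA) / 2) ≤ W.x i) ∧
        (∀ i, t / S.mu0 * (rho * (1 - par.gammaA) / 2) ≤ W.z i) ∧
        W.x ⬝ᵥ W.z ≤ t / S.mu0 * C ∧ ‖W.x‖ ≤ C ∧ ‖W.y‖ ≤ C := by
  set L := K * (par.CN + K * rho + rho) with hL
  refine ⟨|n * (4 * rho ^ 2 + 4 * rho * K)| + |2 * rho + K| + |K + K + L|, by positivity, ?_⟩
  intro S hS t zeta lam w ht0 htle hmu hres
  have hK := hS.P.nonneg
  set τ := t / S.mu0 with hτ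
  have hτ0 : 0 < τ := div_pos ht0 hmu
  have hτ1 : τ ≤ 1 := (div_le_one hmu).2 htle
  obtain ⟨hr1, hr2⟩ := hres
  rw [hS.par_eq, ← hτ] at hr1
  rw [hS.par_eq, hS.rho_eq, ← hτ] at hr2
  have hγ := par.gammaA_lt
  have hγ0 := par.gammaA_pos
  have hCN := par.CN_pos
  have hτρ : 0 < τ * rho := by positivity
  obtain ⟨d, hd1, hd2, hd3⟩ := hS.P.exists_lt (hr2.trans_lt
    (show par.gammaA * rho * τ < (1 + par.gammaA) / 2 * (τ * rho) by nlinarith))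
  obtain ⟨o, ⟨ho1, ho2, ho3, ho4, ho5⟩, hox, hoy, hoz⟩ := hS.P.optimal
  have hdx := (norm_left_le_pairNorm2 d.x d.z).trans hd3.le
  have hdz := (norm_right_le_pairNorm2 d.x d.z).trans hd3.le
  have hdxi : ∀ i, |d.x i| ≤ (1 + par.gammaA) / 2 * (τ * rho) := fun i =>
    (norm_le_pi_norm d.x i).trans hdx
  have hdzi : ∀ i, |d.z i| ≤ (1 + par.gammaA) / 2 * (τ * rho) := fun i =>
    (norm_le_pi_norm d.z i).trans hdz
  have hle : (1 + par.gammaA) / 2 * (τ * rho) ≤ τ * rho := by nlinarith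
  have hle1 : τ * rho ≤ rho := by nlinarith
  have hoxi : ∀ i, o.x i ≤ K := fun i => (le_abs_self _).trans ((norm_le_pi_norm o.x i).trans hox)
  have hozi : ∀ i, o.z i ≤ K := fun i => (le_abs_self _).trans ((norm_le_pi_norm o.z i).trans hoz)
  have hX : ∀ i, (τ • S.w0.x + d.x + (1 - τ) • o.x) i = τ * rho + d.x i + (1 - τ) * o.x i := by
    intro i; simp [w0, startTriple, hS.rho_eq]
  have hZ : ∀ i, (τ • S.w0.z + d.z + (1 - τ) • o.z) i = τ * rho + d.z i + (1 - τ) * o.z i := by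
    intro i; simp [w0, startTriple, hS.rho_eq]
  refine ⟨⟨τ • S.w0.x + d.x + (1 - τ) • o.x, τ • S.w0.y + d.y + (1 - τ) • o.y,
    τ • S.w0.z + d.z + (1 - τ) • o.z⟩, ?_, ?_, ?_, ?_, ?_, ?_, ?_⟩
  · have hb : S.P.A *ᵥ o.x = S.P.b := sub_eq_zero.1 ho2
    simp only [mulVec_sub, mulVec_add, mulVec_smul, hd1, hb, primalResidual, bbar, ← hτ]
    module
  · have hc : o.z = S.P.c + S.P.Q *ᵥ o.x - S.P.Aᵀ *ᵥ o.y := (sub_eq_zero.1 ho1).symm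
    have hdz' : d.z = S.dualResidual t zeta w + S.P.Q *ᵥ d.x - S.P.Aᵀ *ᵥ d.y := by
      rw [← hd2]; abel
    simp only [mulVec_sub, mulVec_add, mulVec_smul, hdz', hc, dualResidual, cbar, ← hτ]
    module
  · intro i
    simp only [hX]
    have h1 := neg_abs_le (d.x i)
    have h2 := hdxi i
    have h3 : 0 ≤ (1 - τ) * o.x i := mul_nonneg (by linarith) (ho4 i)
    linarith
  · intro i
    simp only [hZ]
    have h1 := neg_abs_le (d.z i)
    have h2 := hdzi i
    have h3 : 0 ≤ (1 - τ) * o.z i := mul_nonneg (by linarith) (ho5 i)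
    linarith
  · have hterm : ∀ i, (τ • S.w0.x + d.x + (1 - τ) • o.x) i * (τ • S.w0.z + d.z + (1 - τ) • o.z) i
        ≤ τ * (4 * rho ^ 2 + 4 * rho * K) := by
      intro i
      rw [hX, hZ]
      have h1 := neg_abs_le (d.x i)
      have h1' := le_abs_self (d.x i)
      have h2 := hdxi i
      have h3 := neg_abs_le (d.z i)
      have h3' := le_abs_self (d.z i)
      have h4 := hdzi i
      have hp1 : τ * rho + d.x i ≤ 2 * (τ * rho) := by linarith
      have hr0 : 0 ≤ τ * rho + d.z i := by linarith
      have hr1 : τ * rho + d.z i ≤ 2 * (τ * rho) := by linarith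
      exact mul_convexCombination_le hrho hτ0 hτ1 hp1 hr0 hr1 (ho4 i) (hoxi i) (ho5 i) (hozi i)
        (ho3 i)
    have h1 : (τ • S.w0.x + d.x + (1 - τ) • o.x) ⬝ᵥ (τ • S.w0.z + d.z + (1 - τ) • o.z)
        ≤ n * (τ * (4 * rho ^ 2 + 4 * rho * K)) :=
      (Finset.sum_le_card_nsmul _ _ _ fun i _ => hterm i).trans (by simp)
    refine h1.trans ?_
    have h2 := le_abs_self ((n : ℝ) * (4 * rho ^ 2 + 4 * rho * K))
    have h3 := abs_nonneg (2 * rho + K)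
    have h4 := abs_nonneg (K + K + L)
    calc _ = τ * (n * (4 * rho ^ 2 + 4 * rho * K)) := by ring
      _ ≤ _ := mul_le_mul_of_nonneg_left (by linarith) hτ0.le
  · refine (pi_norm_le_iff_of_nonneg (by positivity)).2 fun i => ?_
    simp only [hX, Real.norm_eq_abs]
    have h1 := neg_abs_le (d.x i)
    have h1' := le_abs_self (d.x i)
    have h2 := hdxi i
    have h3 : 0 ≤ (1 - τ) * o.x i := mul_nonneg (by linarith) (ho4 i)
    have h4 : (1 - τ) * o.x i ≤ K :=
      (mul_le_of_le_one_left (ho4 i) (by linarith)).trans (hoxi i)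
    have h5 := le_abs_self (2 * rho + K)
    have h6 := abs_nonneg ((n : ℝ) * (4 * rho ^ 2 + 4 * rho * K))
    have h7 := abs_nonneg (K + K + L)
    rw [abs_le]
    constructor <;> linarith
  · have h1 : ‖d.y‖ ≤ L := by
      refine (hS.P.le_At _).trans ?_
      have h2 : S.P.Aᵀ *ᵥ d.y = S.dualResidual t zeta w + S.P.Q *ᵥ d.x - d.z := by
        rw [← hd2]; abel
      rw [h2, hL]
      refine mul_le_mul_of_nonneg_left ?_ hK
      refine (norm_sub_le _ _).trans (add_le_add ((norm_add_le _ _).trans (add_le_add ?_ ?_)) ?_)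
      · refine (norm_right_le_pairNorm2 _ _).trans (hr1.trans ?_)
        exact mul_le_of_le_one_right hCN.le hτ1
      · exact (hS.P.Q_le _).trans (mul_le_mul_of_nonneg_left (by linarith) hK)
      · linarith
    have h2 : ‖τ • S.w0.y‖ ≤ K := by
      rw [norm_smul, Real.norm_eq_abs, abs_of_pos hτ0]
      exact (mul_le_of_le_one_left (norm_nonneg _) hτ1).trans hS.y0_le
    have h3 : ‖(1 - τ) • o.y‖ ≤ K := by
      rw [norm_smul, Real.norm_eq_abs, abs_of_nonneg (by linarith)]
      exact (mul_le_of_le_one_left (norm_nonneg _) (by linarith)).trans hoy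
    refine (norm_add_le _ _).trans ((add_le_add ((norm_add_le _ _).trans (add_le_add h2 h1))
      h3).trans ?_)
    have h5 := abs_nonneg (2 * rho + K)
    have h6 := abs_nonneg ((n : ℝ) * (4 * rho ^ 2 + 4 * rho * K))
    have h7 := le_abs_self (K + K + L)
    linarith

theorem mu_pos {w : Triple n m} (hn : 0 < n) (hx : ∀ i, 0 < w.x i) (hz : ∀ i, 0 < w.z i) :
    0 < mu w := by
  have : Nonempty (Fin n) := ⟨⟨0, hn⟩⟩
  exact div_pos (Finset.sum_pos (fun i _ => mul_pos (hx i) (hz i)) Finset.univ_nonempty)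
    (Nat.cast_pos.2 hn)

theorem dotProduct_eq_mul_mu (hn : 0 < n) (w : Triple n m) : w.x ⬝ᵥ w.z = n * mu w := by
  rw [mu, mul_div_cancel₀]
  exact (Nat.cast_pos.2 hn).ne'

/-- The basic estimate for the iterates, relative to a bounded comparison point `(X, Y)`. -/
theorem exists_proximal_bound (hn : 0 < n) (par : Params) (hrho : 0 < rho) (K : ℝ) :
    ∃ C, 0 ≤ C ∧ ∀ S : Setup n m, S.Bounded par rho K → ∀ zeta lam w, (∀ i, 0 < w.x i) →
      (∀ i, 0 < w.z i) → mu w ≤ S.mu0 → S.ResidualBound (mu w) zeta lam w →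
      ∃ (X : Fin n → ℝ) (Y : Fin m → ℝ), ‖X‖ ≤ C ∧ ‖Y‖ ≤ C ∧
        rho * (1 - par.gammaA) / 2 * (∑ i, w.x i + ∑ i, w.z i) +
          rho ^ 2 / 2 * ((Y - w.y) ⬝ᵥ (Y - w.y) + (X - w.x) ⬝ᵥ (X - w.x)) ≤
        C + rho ^ 2 / 2 * ((Y - lam) ⬝ᵥ (Y - lam) + (X - zeta) ⬝ᵥ (X - zeta)) := by
  obtain ⟨C, hC, H⟩ := exists_comparison (n := n) (m := m) par hrho K
  refine ⟨C + n * rho ^ 2, by positivity, fun S hS zeta lam w hx hz hmu hres => ?_⟩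
  have hmu0 : S.mu0 = rho ^ 2 := by rw [mu0_eq hn, hS.rho_eq]
  have ht := mu_pos hn hx hz
  have hpos : 0 < S.mu0 := by rw [hmu0]; positivity
  obtain ⟨W, h1, h2, h3, h4, h5, h6, h7⟩ := H S hS _ zeta lam w ht hmu hpos hres
  have hnr : 0 ≤ (n : ℝ) * rho ^ 2 := by positivity
  refine ⟨W.x, W.y, by linarith, by linarith, ?_⟩
  have h8 := QP.proximal_inequality ht.le h1 h2
  set τ := mu w / S.mu0 with hτ
  have hτ0 : 0 < τ := div_pos ht hpos
  have hmuτ : mu w = τ * rho ^ 2 := by rw [hτ, ← hmu0, div_mul_cancel₀ _ hpos.ne']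
  set θ := rho * (1 - par.gammaA) / 2
  have h9 : τ * θ * ∑ i, w.z i ≤ W.x ⬝ᵥ w.z := by
    rw [Finset.mul_sum]
    exact Finset.sum_le_sum fun i _ => mul_le_mul_of_nonneg_right (h3 i) (hz i).le
  have h10 : τ * θ * ∑ i, w.x i ≤ w.x ⬝ᵥ W.z := by
    rw [Finset.mul_sum]
    refine Finset.sum_le_sum fun i _ => ?_
    rw [mul_comm]
    exact mul_le_mul_of_nonneg_left (h4 i) (hx i).le
  have h11 : (W.x - w.x) ⬝ᵥ (W.z - w.z) =
      W.x ⬝ᵥ W.z - W.x ⬝ᵥ w.z - w.x ⬝ᵥ W.z + n * (τ * rho ^ 2) := by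
    rw [← hmuτ, ← dotProduct_eq_mul_mu hn w]
    simp only [dotProduct_sub, sub_dotProduct]
    ring
  rw [h11, hmuτ] at h8
  refine le_of_mul_le_mul_left ?_ hτ0
  linarith

end Setup

end IPPMM

namespace IPPMM

variable {n m : ℕ}

theorem norm_le_of_dotProduct_self_le {ι : Type*} [Fintype ι] {v : ι → ℝ} {B : ℝ}
    (h : v ⬝ᵥ v ≤ B) : ‖v‖ ≤ B + 1 := by
  nlinarith [sq_norm_le_dotProduct_self v, sq_nonneg (‖v‖ - 1), norm_nonneg v]

theorem dotProduct_sub_self_le {ι : Type*} [Fintype ι] {u v : ι → ℝ} {B : ℝ}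
    (hu : ‖u‖ ≤ B) (hv : ‖v‖ ≤ B) : (u - v) ⬝ᵥ (u - v) ≤ Fintype.card ι * (2 * B) ^ 2 := by
  refine (le_abs_self _).trans ((abs_dotProduct_le _ _).trans ?_)
  have h : ‖u - v‖ ≤ 2 * B := (norm_sub_le _ _).trans (by linarith)
  have h0 : 0 ≤ 2 * B := (norm_nonneg _).trans h
  rw [sq]
  gcongr

theorem norm_le_of_sum_le {ι : Type*} [Fintype ι] {v : ι → ℝ} {B : ℝ} (hB : 0 ≤ B)
    (hv : ∀ i, 0 < v i) (h : ∑ i, v i ≤ B) : ‖v‖ ≤ B := by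
  refine (pi_norm_le_iff_of_nonneg hB).2 fun i => ?_
  rw [Real.norm_eq_abs, abs_of_pos (hv i)]
  exact (Finset.single_le_sum (fun j _ => (hv j).le) (Finset.mem_univ i)).trans h

/-- If `Z hₓ + X h_z = r` with `r = O(μ)`, `hₓᵀ h_z ≥ 0` and `xᵢ zᵢ ≥ γ μ`, then `hₓ` and `h_z` are
bounded relative to `x` and `z`. -/
theorem abs_le_of_complementarity_eq {x z hx hz r : Fin n → ℝ} {γ μ R : ℝ} (hγ : 0 < γ)
    (hμ : 0 < μ) (hR : 0 ≤ R) (hxp : ∀ i, 0 < x i) (hzp : ∀ i, 0 < z i)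
    (hc : ∀ i, γ * μ ≤ x i * z i) (hdot : 0 ≤ hx ⬝ᵥ hz)
    (heq : ∀ i, z i * hx i + x i * hz i = r i) (hr : ∀ i, |r i| ≤ R * μ) (i : Fin n) :
    |hx i| ≤ n * R / γ * x i ∧ |hz i| ≤ n * R / γ * z i := by
  have hxz : ∀ i, 0 < x i * z i := fun i => mul_pos (hxp i) (hzp i)
  set D : Fin n → ℝ := fun i => ((z i * hx i) ^ 2 + (x i * hz i) ^ 2) / (x i * z i) with hD
  have hD0 : ∀ i, 0 ≤ D i := fun i => div_nonneg (by positivity) (hxz i).le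
  have hDi : ∀ i, D i ≤ R ^ 2 * μ / γ - 2 * (hx i * hz i) := by
    intro i
    have h1 : D i = r i ^ 2 / (x i * z i) - 2 * (hx i * hz i) := by
      rw [hD, ← heq]
      have := (hxz i).ne'
      have := (hxp i).ne'
      have := (hzp i).ne'
      field_simp
      ring
    have h2 : r i ^ 2 / (x i * z i) ≤ R ^ 2 * μ / γ := by
      have h3 : r i ^ 2 ≤ (R * μ) ^ 2 := sq_le_sq' (by linarith [neg_abs_le (r i), hr i])
        ((le_abs_self _).trans (hr i))
      rw [div_le_div_iff₀ (hxz i) hγ]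
      calc r i ^ 2 * γ ≤ (R * μ) ^ 2 * γ := mul_le_mul_of_nonneg_right h3 hγ.le
        _ = R ^ 2 * μ * (γ * μ) := by ring
        _ ≤ _ := mul_le_mul_of_nonneg_left (hc i) (by positivity)
    rw [h1]
    linarith
  have hsum : ∑ j, D j ≤ n * (R ^ 2 * μ / γ) := by
    refine (Finset.sum_le_sum fun j _ => hDi j).trans ?_
    rw [Finset.sum_sub_distrib, ← Finset.mul_sum]
    have : ∑ j, hx j * hz j = hx ⬝ᵥ hz := rfl
    simp only [Finset.sum_const, Finset.card_univ, Fintype.card_fin, nsmul_eq_mul, this]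
    linarith
  have hone : D i ≤ n * (R ^ 2 * μ / γ) :=
    (Finset.single_le_sum (fun j _ => hD0 j) (Finset.mem_univ i)).trans hsum
  have hn1 : (1 : ℝ) ≤ n := by exact_mod_cast i.pos
  have hsq : (z i * hx i) ^ 2 + (x i * hz i) ^ 2 ≤ (n * R / γ * (x i * z i)) ^ 2 := by
    have h1 := (div_le_iff₀ (hxz i)).1 hone
    refine h1.trans ?_
    have h2 : (n * R / γ * (x i * z i)) ^ 2 =
        (n * R ^ 2 / γ ^ 2) * (x i * z i) * (n * (x i * z i)) := by
      field_simp
    have h3 : n * (R ^ 2 * μ / γ) * (x i * z i) =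
        (n * R ^ 2 / γ ^ 2) * (x i * z i) * (γ * μ) := by
      field_simp
    rw [h2, h3]
    refine mul_le_mul_of_nonneg_left ?_ (mul_nonneg (by positivity) (hxz i).le)
    nlinarith [hc i, hxz i]
  have hB : 0 ≤ n * R / γ * (x i * z i) := mul_nonneg (by positivity) (hxz i).le
  constructor
  · have h1 : |z i * hx i| ≤ n * R / γ * (x i * z i) :=
      abs_le_of_sq_le_sq (by nlinarith [sq_nonneg (x i * hz i)]) hB
    rw [abs_mul, abs_of_pos (hzp i)] at h1
    refine le_of_mul_le_mul_left ?_ (hzp i)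
    linarith
  · have h1 : |x i * hz i| ≤ n * R / γ * (x i * z i) :=
      abs_le_of_sq_le_sq (by nlinarith [sq_nonneg (z i * hx i)]) hB
    rw [abs_mul, abs_of_pos (hxp i)] at h1
    refine le_of_mul_le_mul_left ?_ (hxp i)
    linarith

namespace Setup

variable {par : Params} {rho K : ℝ}

/-- The properties of the states of the algorithm that are preserved by its iterations. -/
structure Invariant (S : Setup n m) (L : ℝ) (s : State n m) : Prop where
  x_pos : ∀ i, 0 < s.w.x i
  z_pos : ∀ i, 0 < s.w.z i
  central : ∀ i, S.par.gammaMu * mu s.w ≤ s.w.x i * s.w.z i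
  mu_le : mu s.w ≤ S.mu0
  residual : S.ResidualBound (mu s.w) s.zeta s.lam s.w
  zeta_le : ‖s.zeta‖ ≤ L
  lam_le : ‖s.lam‖ ≤ L

/-- An iterate that passes the update test is bounded, independently of the estimates. -/
theorem exists_updated_bound (hn : 0 < n) (par : Params) (hrho : 0 < rho) (K : ℝ) :
    ∃ C, 0 ≤ C ∧ ∀ S : Setup n m, S.Bounded par rho K → ∀ w, (∀ i, 0 < w.x i) →
      (∀ i, 0 < w.z i) → mu w ≤ S.mu0 → S.ResidualBound (mu w) w.x w.y w →
      ‖w.x‖ ≤ C ∧ ‖w.y‖ ≤ C := by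
  obtain ⟨C, hC, H⟩ := exists_proximal_bound (m := m) hn par hrho K
  set θ := rho * (1 - par.gammaA) / 2
  have hθ0 : 0 < θ := by
    have := par.gammaA_lt
    have : 0 < 1 - par.gammaA := by linarith
    positivity
  set D := C / θ
  have hD : 0 ≤ D := by positivity
  refine ⟨|D| + |K * (par.CN + K * D + D + K + (K * rho + K * K + rho + K))|, by positivity,
    fun S hS w hx hz hmu hres => ?_⟩
  have hK := hS.P.nonneg
  have hmu0 : S.mu0 = rho ^ 2 := by rw [mu0_eq hn, hS.rho_eq]
  have hpos : 0 < S.mu0 := by rw [hmu0]; positivity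
  have ht := mu_pos hn hx hz
  obtain ⟨X, Y, -, -, h⟩ := H S hS _ _ w hx hz hmu hres
  have h1 : ∑ i, w.x i + ∑ i, w.z i ≤ D := by
    rw [le_div_iff₀ hθ0]
    linarith
  have hxn : ‖w.x‖ ≤ D := norm_le_of_sum_le hD hx
    (by linarith [Finset.sum_nonneg fun i (_ : i ∈ Finset.univ) => (hz i).le])
  have hzn : ‖w.z‖ ≤ D := norm_le_of_sum_le hD hz
    (by linarith [Finset.sum_nonneg fun i (_ : i ∈ Finset.univ) => (hx i).le])
  have hyn : ‖w.y‖ ≤ K * (par.CN + K * D + D + K + (K * rho + K * K + rho + K)) := by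
    refine (hS.P.le_At _).trans (mul_le_mul_of_nonneg_left ?_ hK)
    have h2 : S.P.Aᵀ *ᵥ w.y = S.dualResidual (mu w) w.x w + S.P.Q *ᵥ w.x - w.z + S.P.c +
        (mu w / S.mu0) • S.cbar := by
      rw [dualResidual]
      module
    have hτ : mu w / S.mu0 ≤ 1 := (div_le_one hpos).2 hmu
    have hτ0 : 0 < mu w / S.mu0 := div_pos ht hpos
    rw [h2]
    refine (norm_add_le _ _).trans (add_le_add ((norm_add_le _ _).trans (add_le_add
      ((norm_sub_le _ _).trans (add_le_add ((norm_add_le _ _).trans (add_le_add ?_ ?_)) hzn))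
      hS.P.c_le)) ?_)
    · have h3 := (norm_right_le_pairNorm2 _ _).trans hres.1
      rw [hS.par_eq] at h3
      exact h3.trans (mul_le_of_le_one_right par.CN_pos.le hτ)
    · exact (hS.P.Q_le _).trans (mul_le_mul_of_nonneg_left hxn hK)
    · rw [norm_smul, Real.norm_eq_abs, abs_of_pos hτ0]
      exact (mul_le_of_le_one_left (norm_nonneg _) hτ).trans (hS.norm_cbar_le hrho.le)
  exact ⟨(hxn.trans (le_abs_self _)).trans (le_add_of_nonneg_right (abs_nonneg _)),
    (hyn.trans (le_abs_self _)).trans (le_add_of_nonneg_left (abs_nonneg _))⟩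

/-- The iterates are bounded in terms of a bound of the proximal estimates. -/
theorem exists_iterate_bound (hn : 0 < n) (par : Params) (hrho : 0 < rho) (K L : ℝ) :
    ∃ C, 0 ≤ C ∧ ∀ S : Setup n m, S.Bounded par rho K → ∀ s, S.Invariant L s →
      ‖s.w.x‖ ≤ C ∧ ‖s.w.y‖ ≤ C ∧ ‖s.w.z‖ ≤ C := by
  obtain ⟨C, hC, H⟩ := exists_proximal_bound (m := m) hn par hrho K
  set θ := rho * (1 - par.gammaA) / 2
  have hθ0 : 0 < θ := by
    have := par.gammaA_lt
    have : 0 < 1 - par.gammaA := by linarith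
    positivity
  set B := C + |L|
  set R := C + rho ^ 2 / 2 * (m * (2 * B) ^ 2 + n * (2 * B) ^ 2) with hR
  have hR0 : 0 ≤ R := by positivity
  have h1 : 0 ≤ R / θ := by positivity
  have h2 : 0 ≤ R / (rho ^ 2 / 2) + 1 := by positivity
  refine ⟨R / θ + (C + (R / (rho ^ 2 / 2) + 1)), by positivity, fun S hS s hs => ?_⟩
  obtain ⟨X, Y, hX, hY, h⟩ := H S hS _ _ s.w hs.x_pos hs.z_pos hs.mu_le hs.residual
  have h3 := dotProduct_sub_self_le (hY.trans (le_add_of_nonneg_right (abs_nonneg L)))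
    ((hs.lam_le.trans (le_abs_self L)).trans (le_add_of_nonneg_left hC))
  have h4 := dotProduct_sub_self_le (hX.trans (le_add_of_nonneg_right (abs_nonneg L)))
    ((hs.zeta_le.trans (le_abs_self L)).trans (le_add_of_nonneg_left hC))
  rw [Fintype.card_fin] at h3 h4
  have hrho2 : 0 < rho ^ 2 / 2 := by positivity
  have h5 : θ * (∑ i, s.w.x i + ∑ i, s.w.z i) + rho ^ 2 / 2 * ((Y - s.w.y) ⬝ᵥ (Y - s.w.y) +
      (X - s.w.x) ⬝ᵥ (X - s.w.x)) ≤ R :=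
    h.trans (add_le_add_right (mul_le_mul_of_nonneg_left (add_le_add h3 h4) hrho2.le) _)
  have hxs := Finset.sum_nonneg fun i (_ : i ∈ Finset.univ) => (hs.x_pos i).le
  have hzs := Finset.sum_nonneg fun i (_ : i ∈ Finset.univ) => (hs.z_pos i).le
  have hy0 := dotProduct_self_nonneg_real (Y - s.w.y)
  have hx0 := dotProduct_self_nonneg_real (X - s.w.x)
  have h6 : ∑ i, s.w.x i + ∑ i, s.w.z i ≤ R / θ := by
    rw [le_div_iff₀ hθ0]
    nlinarith
  have h7 : (Y - s.w.y) ⬝ᵥ (Y - s.w.y) ≤ R / (rho ^ 2 / 2) := by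
    rw [le_div_iff₀ hrho2]
    nlinarith
  have h8 := norm_le_of_dotProduct_self_le h7
  have h9 : ‖s.w.x‖ ≤ R / θ := norm_le_of_sum_le h1 hs.x_pos (by linarith)
  have h10 : ‖s.w.z‖ ≤ R / θ := norm_le_of_sum_le h1 hs.z_pos (by linarith)
  have h11 : ‖s.w.y‖ ≤ ‖Y‖ + ‖Y - s.w.y‖ := by
    have := norm_sub_le Y (Y - s.w.y)
    rwa [sub_sub_cancel] at this
  exact ⟨by linarith, by linarith, by linarith⟩

/-- The drift of the primal residual per unit of the barrier parameter. -/
noncomputable def primalDrift (S : Setup n m) (s : State n m) : Fin m → ℝ :=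
  (s.w.y - s.lam) - S.mu0⁻¹ • S.bbar

/-- The drift of the dual residual per unit of the barrier parameter. -/
noncomputable def dualDrift (S : Setup n m) (s : State n m) : Fin n → ℝ :=
  -(s.w.x - s.zeta) - S.mu0⁻¹ • S.cbar

theorem IsNewtonDirection.primal_eq {S : Setup n m} {s : State n m} {σ : ℝ} {d : Triple n m}
    (h : S.IsNewtonDirection s σ d) :
    S.P.A *ᵥ d.x + mu s.w • d.y = -S.primalResidual (mu s.w) s.lam s.w +
      ((1 - σ) * mu s.w) • S.primalDrift s := by
  rw [h.2.1, primalResidual, primalDrift, div_eq_mul_inv, div_eq_mul_inv]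
  module

theorem IsNewtonDirection.dual_eq {S : Setup n m} {s : State n m} {σ : ℝ} {d : Triple n m}
    (h : S.IsNewtonDirection s σ d) :
    -(S.P.Q *ᵥ d.x) - mu s.w • d.x + S.P.Aᵀ *ᵥ d.y + d.z =
      -S.dualResidual (mu s.w) s.zeta s.w + ((1 - σ) * mu s.w) • S.dualDrift s := by
  have h1 := h.1
  rw [add_mulVec, smul_mulVec, one_mulVec, neg_add, ← sub_eq_add_neg] at h1
  rw [h1, dualResidual, dualDrift, div_eq_mul_inv, div_eq_mul_inv]
  module

/-- The residual at a trial point along the Newton direction, for any barrier parameter `t`. -/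
theorem IsNewtonDirection.primalResidual_move {S : Setup n m} {s : State n m} {σ : ℝ}
    {d : Triple n m} (h : S.IsNewtonDirection s σ d) (α t : ℝ) :
    S.primalResidual t s.lam (s.w.move α d) =
      (1 - α) • S.primalResidual (mu s.w) s.lam s.w +
        ((t - mu s.w + α * (1 - σ) * mu s.w) • S.primalDrift s + (α * (t - mu s.w)) • d.y) := by
  have h1 : S.P.A *ᵥ d.x = -S.primalResidual (mu s.w) s.lam s.w +
      ((1 - σ) * mu s.w) • S.primalDrift s - mu s.w • d.y := by
    rw [← h.primal_eq]; abel
  simp only [primalResidual, Triple.move, mulVec_add, mulVec_smul, h1]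
  simp only [primalDrift, div_eq_mul_inv]
  module

theorem IsNewtonDirection.dualResidual_move {S : Setup n m} {s : State n m} {σ : ℝ}
    {d : Triple n m} (h : S.IsNewtonDirection s σ d) (α t : ℝ) :
    S.dualResidual t s.zeta (s.w.move α d) =
      (1 - α) • S.dualResidual (mu s.w) s.zeta s.w +
        ((t - mu s.w + α * (1 - σ) * mu s.w) • S.dualDrift s + (-(α * (t - mu s.w))) • d.x) := by
  have h1 : d.z = -S.dualResidual (mu s.w) s.zeta s.w +
      ((1 - σ) * mu s.w) • S.dualDrift s + S.P.Q *ᵥ d.x + mu s.w • d.x - S.P.Aᵀ *ᵥ d.y := by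
    rw [← h.dual_eq]; abel
  simp only [dualResidual, Triple.move, mulVec_add, mulVec_smul, h1]
  simp only [dualDrift, div_eq_mul_inv]
  module

end Setup

end IPPMM

namespace IPPMM

variable {n m : ℕ}

theorem mul_le_mul_mu (hn : 0 < n) {w : Triple n m} (hx : ∀ i, 0 < w.x i) (hz : ∀ i, 0 < w.z i)
    (i : Fin n) : w.x i * w.z i ≤ n * mu w := by
  rw [← Setup.dotProduct_eq_mul_mu hn w]
  exact Finset.single_le_sum (f := fun j => w.x j * w.z j)
    (fun j _ => (mul_pos (hx j) (hz j)).le) (Finset.mem_univ i)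

/-- For the homogeneous regularized equations, the complementarity product is nonnegative. -/
theorem QP.dotProduct_nonneg_of_homogeneous {P : QP n m} {t : ℝ} (ht : 0 ≤ t) {hx hz : Fin n → ℝ}
    {hy : Fin m → ℝ} (h1 : P.A *ᵥ hx + t • hy = 0)
    (h2 : -(P.Q *ᵥ hx) - t • hx + P.Aᵀ *ᵥ hy + hz = 0) : 0 ≤ hx ⬝ᵥ hz := by
  have h3 := QP.le_dotProduct_of_eq (P := P) (hx := hx) (hz := hz) (q := t • hx) (hy := hy)
    (eq_neg_of_add_eq_zero_left h1) (by
      rw [← sub_eq_zero, ← h2]; abel)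
  refine le_trans ?_ h3
  rw [dotProduct_neg, dotProduct_smul, dotProduct_smul, sub_neg_eq_add]
  exact add_nonneg (mul_nonneg ht (dotProduct_self_nonneg_real _))
    (mul_nonneg ht (dotProduct_self_nonneg_real _))

/-- Solutions of a regularized Newton system with a right-hand side of order `t` are bounded
relative to `x` and `z`. -/
theorem QP.Bounded.newton_bound {P : QP n m} {K : ℝ} (hP : P.Bounded K) {B M T γ σ t : ℝ}
    {x z dx dz q : Fin n → ℝ} {dy p : Fin m → ℝ} (hγ : 0 < γ) (ht : 0 < t) (htT : t ≤ T)
    (hB : 0 ≤ B) (hM : 0 ≤ M) (hσ0 : 0 ≤ σ) (hσ1 : σ ≤ 1) (hp : ‖p‖ ≤ B * t) (hq : ‖q‖ ≤ B * t)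
    (hx : ∀ i, 0 < x i) (hz : ∀ i, 0 < z i) (hxM : ∀ i, x i ≤ M) (hzM : ∀ i, z i ≤ M)
    (hc : ∀ i, γ * t ≤ x i * z i) (hcn : ∀ i, x i * z i ≤ n * t)
    (h1 : P.A *ᵥ dx + t • dy = p) (h2 : -(P.Q *ᵥ dx) - t • dx + P.Aᵀ *ᵥ dy + dz = q)
    (h3 : ∀ i, z i * dx i + x i * dz i = σ * t - x i * z i)
    {E : ℝ} (hE : E = K * B + (B + K * (K * B) + T * (K * B))) (i : Fin n) :
    |dx i| ≤ (n * (1 + n + 2 * (M * E)) / γ + E * M / γ) * x i ∧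
      |dz i| ≤ (n * (1 + n + 2 * (M * E)) / γ + E * M / γ) * z i := by
  have hK := hP.nonneg
  have hT : 0 ≤ T := ht.le.trans htT
  obtain ⟨v, hv, hvn⟩ := hP.right_inv p
  have hvt : ‖v‖ ≤ K * B * t := by
    refine hvn.trans ((mul_le_mul_of_nonneg_left hp hK).trans_eq (by ring))
  set w := q + P.Q *ᵥ v + t • v with hw
  have hwt : ‖w‖ ≤ (B + K * (K * B) + T * (K * B)) * t := by
    have h4 : ‖P.Q *ᵥ v‖ ≤ K * (K * B * t) :=
      (hP.Q_le v).trans (mul_le_mul_of_nonneg_left hvt hK)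
    have h5 : ‖t • v‖ ≤ T * (K * B * t) := by
      rw [norm_smul, Real.norm_eq_abs, abs_of_pos ht]
      exact mul_le_mul htT hvt (norm_nonneg _) hT
    refine (norm_add_le _ _).trans ((add_le_add ((norm_add_le _ _).trans (add_le_add hq h4))
      h5).trans_eq (by ring))
  have hE1 : K * B ≤ E := by rw [hE]; exact le_add_of_nonneg_right (by positivity)
  have hE2 : B + K * (K * B) + T * (K * B) ≤ E := by
    rw [hE]; exact le_add_of_nonneg_left (by positivity)
  have hE0 : 0 ≤ E := le_trans (by positivity) hE1
  have hvE : ∀ i, |v i| ≤ E * t := fun i =>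
    (norm_le_pi_norm v i).trans (hvt.trans (mul_le_mul_of_nonneg_right hE1 ht.le))
  have hwE : ∀ i, |w i| ≤ E * t := fun i =>
    (norm_le_pi_norm w i).trans (hwt.trans (mul_le_mul_of_nonneg_right hE2 ht.le))
  have hdot : 0 ≤ (dx - v) ⬝ᵥ (dz - w) := by
    refine QP.dotProduct_nonneg_of_homogeneous (P := P) ht.le (hy := dy) ?_ ?_
    · rw [mulVec_sub, hv, ← h1]; abel
    · rw [mulVec_sub, hw, ← h2]; module
  have hr : ∀ i, |σ * t - x i * z i - z i * v i - x i * w i| ≤ (1 + n + 2 * (M * E)) * t := by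
    intro i
    have h4 : |z i * v i| ≤ M * (E * t) := by
      rw [abs_mul, abs_of_pos (hz i)]
      exact mul_le_mul (hzM i) (hvE i) (abs_nonneg _) hM
    have h5 : |x i * w i| ≤ M * (E * t) := by
      rw [abs_mul, abs_of_pos (hx i)]
      exact mul_le_mul (hxM i) (hwE i) (abs_nonneg _) hM
    have h6 : σ * t ≤ t := mul_le_of_le_one_left ht.le hσ1
    have h7 : 0 ≤ σ * t := mul_nonneg hσ0 ht.le
    have h8 := hcn i
    have h9 : 0 < x i * z i := mul_pos (hx i) (hz i)
    rw [abs_le] at h4 h5 ⊢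
    constructor <;> linarith
  have key := abs_le_of_complementarity_eq (R := 1 + n + 2 * (M * E)) hγ ht (by positivity) hx hz
    hc hdot (r := fun i => σ * t - x i * z i - z i * v i - x i * w i)
    (fun i => by simp only [Pi.sub_apply]; linarith [h3 i]) hr i
  have hsmall : ∀ a b : ℝ, 0 < a → b ≤ M → γ * t ≤ a * b → E * t ≤ E * M / γ * a := by
    intro a b ha hb hab
    rw [div_mul_eq_mul_div, le_div_iff₀ hγ]
    calc E * t * γ = E * (γ * t) := by ring
      _ ≤ E * (a * b) := mul_le_mul_of_nonneg_left hab hE0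
      _ ≤ E * (a * M) := by gcongr
      _ = _ := by ring
  constructor
  · have h4 : |dx i| ≤ |(dx - v) i| + |v i| := by
      have := abs_add_le ((dx - v) i) (v i)
      rwa [Pi.sub_apply, sub_add_cancel] at this
    rw [add_mul]
    exact h4.trans (add_le_add key.1 ((hvE i).trans (hsmall _ _ (hx i) (hzM i) (hc i))))
  · have h4 : |dz i| ≤ |(dz - w) i| + |w i| := by
      have := abs_add_le ((dz - w) i) (w i)
      rwa [Pi.sub_apply, sub_add_cancel] at this
    rw [add_mul]
    exact h4.trans (add_le_add key.2 ((hwE i).trans (hsmall _ _ (hz i) (hxM i)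
      ((hc i).trans_eq (mul_comm _ _)))))

theorem norm_le_of_abs_le_mul {ι : Type*} [Fintype ι] {u v : ι → ℝ} {C : ℝ} (hC : 0 ≤ C)
    (h : ∀ i, |u i| ≤ C * v i) : ‖u‖ ≤ C * ‖v‖ :=
  (pi_norm_le_iff_of_nonneg (by positivity)).2 fun i => (h i).trans
    (mul_le_mul_of_nonneg_left ((le_abs_self _).trans (norm_le_pi_norm v i)) hC)

namespace Setup

variable {par : Params} {rho K : ℝ}

theorem exists_drift_bound (hn : 0 < n) (par : Params) (hrho : 0 < rho) (K L : ℝ) :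
    ∃ C, 0 ≤ C ∧ ∀ S : Setup n m, S.Bounded par rho K → ∀ s, S.Invariant L s →
      ‖S.primalDrift s‖ ≤ C ∧ ‖S.dualDrift s‖ ≤ C := by
  obtain ⟨M, hM, H⟩ := exists_iterate_bound (m := m) hn par hrho K L
  set D := (rho ^ 2)⁻¹ * (|K * rho + K| + |K * rho + K * K + rho + K|)
  refine ⟨M + |L| + D, by positivity, fun S hS s hs => ?_⟩
  obtain ⟨hx, hy, -⟩ := H S hS s hs
  have hmu0 : S.mu0 = rho ^ 2 := by rw [mu0_eq hn, hS.rho_eq]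
  have hi : 0 < (rho ^ 2)⁻¹ := by positivity
  have h1 := (hS.norm_bbar_le hrho.le).trans (le_abs_self _)
  have h2 := (hS.norm_cbar_le hrho.le).trans (le_abs_self _)
  have h3 := abs_nonneg (K * rho + K)
  have h4 := abs_nonneg (K * rho + K * K + rho + K)
  constructor
  · refine (norm_sub_le _ _).trans (add_le_add ((norm_sub_le _ _).trans (add_le_add hy
      (hs.lam_le.trans (le_abs_self L)))) ?_)
    rw [norm_smul, hmu0, Real.norm_eq_abs, abs_of_pos hi]
    exact mul_le_mul_of_nonneg_left (by linarith) hi.le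
  · refine (norm_sub_le _ _).trans (add_le_add ((norm_neg _).trans_le ((norm_sub_le _ _).trans
      (add_le_add hx (hs.zeta_le.trans (le_abs_self L))))) ?_)
    rw [norm_smul, hmu0, Real.norm_eq_abs, abs_of_pos hi]
    exact mul_le_mul_of_nonneg_left (by linarith) hi.le

/-- The Newton direction is uniformly bounded, in `x` and `z` relative to the iterate. -/
theorem exists_newton_bound (hn : 0 < n) (par : Params) (hrho : 0 < rho) (K L : ℝ) :
    ∃ C, 0 ≤ C ∧ ∀ S : Setup n m, S.Bounded par rho K → ∀ s, S.Invariant L s →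
      ∀ σ d, 0 ≤ σ → σ ≤ 1 → S.IsNewtonDirection s σ d →
      (∀ i, |d.x i| ≤ C * s.w.x i) ∧ (∀ i, |d.z i| ≤ C * s.w.z i) ∧ ‖d.x‖ ≤ C ∧ ‖d.y‖ ≤ C := by
  obtain ⟨M, hM, HM⟩ := exists_iterate_bound (m := m) hn par hrho K L
  obtain ⟨G, hG, HG⟩ := exists_drift_bound (m := m) hn par hrho K L
  have hCN := par.CN_pos
  have hγ := par.gammaMu_pos
  set B := par.CN / rho ^ 2 + G with hB
  have hB0 : 0 ≤ B := by positivity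
  set E := |K| * B + (B + |K| * (|K| * B) + rho ^ 2 * (|K| * B)) with hE
  have hE0 : 0 ≤ E := by positivity
  set C := n * (1 + n + 2 * (M * E)) / par.gammaMu + E * M / par.gammaMu with hC
  have hC0 : 0 ≤ C := by positivity
  set Y := |K| * (B * rho ^ 2 + |K| * (C * M) + rho ^ 2 * (C * M) + C * M) with hY
  have hY0 : 0 ≤ Y := by positivity
  refine ⟨C + C * M + Y, by positivity, fun S hS s hs σ d hσ0 hσ1 hd => ?_⟩
  have hK := hS.P.nonneg
  rw [abs_of_nonneg hK] at hE hY
  obtain ⟨hx, hy, hz⟩ := HM S hS s hs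
  obtain ⟨hg1, hg2⟩ := HG S hS s hs
  have hmu0 : S.mu0 = rho ^ 2 := by rw [mu0_eq hn, hS.rho_eq]
  have ht := mu_pos hn hs.x_pos hs.z_pos
  have hσt : ‖(1 - σ) * mu s.w‖ ≤ mu s.w := by
    rw [Real.norm_eq_abs, abs_of_nonneg (mul_nonneg (by linarith) ht.le)]
    exact mul_le_of_le_one_left ht.le (by linarith)
  have hCNt : S.par.CN * (mu s.w / S.mu0) = par.CN / rho ^ 2 * mu s.w := by
    rw [hS.par_eq, hmu0]; ring
  have hres := hs.residual.1
  rw [hCNt] at hres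
  have hp : ‖-S.primalResidual (mu s.w) s.lam s.w + ((1 - σ) * mu s.w) • S.primalDrift s‖ ≤
      B * mu s.w := by
    refine (norm_add_le _ _).trans ((add_le_add ((norm_neg _).trans_le
      ((norm_left_le_pairNorm2 _ _).trans hres)) ((norm_smul_le _ _).trans
      (mul_le_mul hσt hg1 (norm_nonneg _) ht.le))).trans_eq ?_)
    rw [hB]; ring
  have hq : ‖-S.dualResidual (mu s.w) s.zeta s.w + ((1 - σ) * mu s.w) • S.dualDrift s‖ ≤
      B * mu s.w := by
    refine (norm_add_le _ _).trans ((add_le_add ((norm_neg _).trans_le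
      ((norm_right_le_pairNorm2 _ _).trans hres)) ((norm_smul_le _ _).trans
      (mul_le_mul hσt hg2 (norm_nonneg _) ht.le))).trans_eq ?_)
    rw [hB]; ring
  have hmuT : mu s.w ≤ rho ^ 2 := hmu0 ▸ hs.mu_le
  have key := hS.P.newton_bound (γ := par.gammaMu) hγ ht hmuT hB0 hM hσ0 hσ1 hp hq hs.x_pos
    hs.z_pos (fun i => (le_abs_self _).trans ((norm_le_pi_norm s.w.x i).trans hx))
    (fun i => (le_abs_self _).trans ((norm_le_pi_norm s.w.z i).trans hz))
    (fun i => hS.par_eq ▸ hs.central i) (mul_le_mul_mu hn hs.x_pos hs.z_pos) hd.primal_eq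
    hd.dual_eq (fun i => by rw [hd.2.2 i]; ring) hE
  have hdx : ‖d.x‖ ≤ C * M := (norm_le_of_abs_le_mul hC0 fun i => (key i).1).trans
    (mul_le_mul_of_nonneg_left hx hC0)
  have hdz : ‖d.z‖ ≤ C * M := (norm_le_of_abs_le_mul hC0 fun i => (key i).2).trans
    (mul_le_mul_of_nonneg_left hz hC0)
  have hCM : 0 ≤ C * M := by positivity
  have hdy : ‖d.y‖ ≤ Y := by
    refine (hS.P.le_At _).trans ?_
    rw [hY]
    refine mul_le_mul_of_nonneg_left ?_ hK
    have h1 : S.P.Aᵀ *ᵥ d.y = (-S.dualResidual (mu s.w) s.zeta s.w +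
        ((1 - σ) * mu s.w) • S.dualDrift s) + S.P.Q *ᵥ d.x + mu s.w • d.x - d.z := by
      rw [← hd.dual_eq]; abel
    rw [h1]
    refine (norm_sub_le _ _).trans (add_le_add ((norm_add_le _ _).trans (add_le_add
      ((norm_add_le _ _).trans (add_le_add ?_ ?_)) ?_)) hdz)
    · exact hq.trans (mul_le_mul_of_nonneg_left hmuT hB0)
    · exact (hS.P.Q_le _).trans (mul_le_mul_of_nonneg_left hdx hK)
    · rw [norm_smul, Real.norm_eq_abs, abs_of_pos ht]
      exact mul_le_mul hmuT hdx (norm_nonneg _) (by positivity)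
  refine ⟨fun i => (key i).1.trans (mul_le_mul_of_nonneg_right (by linarith) (hs.x_pos i).le),
    fun i => (key i).2.trans (mul_le_mul_of_nonneg_right (by linarith) (hs.z_pos i).le),
    by linarith, by linarith⟩

/-- The coefficient map of the Newton system. -/
def newtonMap (P : QP n m) (w : Triple n m) (t : ℝ) :
    (Fin n → ℝ) × (Fin m → ℝ) × (Fin n → ℝ) →ₗ[ℝ] (Fin n → ℝ) × (Fin m → ℝ) × (Fin n → ℝ) where
  toFun d := (-((P.Q + t • (1 : Matrix (Fin n) (Fin n) ℝ)) *ᵥ d.1) + P.Aᵀ *ᵥ d.2.1 + d.2.2,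
    P.A *ᵥ d.1 + t • d.2.1, w.z * d.1 + w.x * d.2.2)
  map_add' d d' := by
    simp only [Prod.fst_add, Prod.snd_add, mulVec_add, smul_add, mul_add, Prod.mk_add_mk]
    refine Prod.ext ?_ (Prod.ext ?_ ?_) <;> simp only <;> abel
  map_smul' r d := by
    simp only [Prod.smul_fst, Prod.smul_snd, mulVec_smul, mul_smul_comm, Prod.smul_mk,
      RingHom.id_apply]
    refine Prod.ext ?_ (Prod.ext ?_ ?_) <;> simp only <;> module

theorem newtonMap_bijective {P : QP n m} {w : Triple n m} {t : ℝ} (ht : 0 < t)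
    (hx : ∀ i, 0 < w.x i) (hz : ∀ i, 0 < w.z i) : Function.Bijective (newtonMap P w t) := by
  have hinj : Function.Injective (newtonMap P w t) := by
    rw [← LinearMap.ker_eq_bot, LinearMap.ker_eq_bot']
    rintro ⟨dx, dy, dz⟩ h
    obtain ⟨h1, h2, h3⟩ : _ ∧ _ ∧ _ := by simpa only [Prod.ext_iff] using h
    simp only [newtonMap, LinearMap.coe_mk, AddHom.coe_mk, Prod.fst_zero, Prod.snd_zero]
      at h1 h2 h3
    have hdot := QP.dotProduct_nonneg_of_homogeneous ht.le h2 (by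
      rw [add_mulVec, smul_mulVec, one_mulVec, neg_add, ← sub_eq_add_neg] at h1
      exact h1)
    have hpos : ∃ γ, 0 < γ ∧ ∀ i, γ * t ≤ w.x i * w.z i := by
      rcases isEmpty_or_nonempty (Fin n) with hE | hE
      · exact ⟨1, one_pos, fun i => hE.elim i⟩
      · obtain ⟨j, hj⟩ := Finite.exists_min fun i => w.x i * w.z i
        refine ⟨w.x j * w.z j / t, div_pos (mul_pos (hx j) (hz j)) ht, fun i => ?_⟩
        rw [div_mul_cancel₀ _ ht.ne']
        exact hj i
    obtain ⟨γ, hγ, hc⟩ := hpos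
    have key := abs_le_of_complementarity_eq (R := 0) (r := 0) hγ ht le_rfl hx hz hc hdot
      (fun i => congrFun h3 i) (by simp)
    simp only [mul_zero, zero_div, zero_mul] at key
    have hdx : dx = 0 := funext fun i => abs_nonpos_iff.1 (key i).1
    have hdz : dz = 0 := funext fun i => abs_nonpos_iff.1 (key i).2
    have hdy : dy = 0 := by
      rw [hdx, mulVec_zero, zero_add] at h2
      exact (smul_eq_zero.1 h2).resolve_left ht.ne'
    rw [hdx, hdy, hdz]
    rfl
  exact ⟨hinj, LinearMap.injective_iff_surjective.1 hinj⟩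

theorem existsUnique_isNewtonDirection (S : Setup n m) {s : State n m} (σ : ℝ)
    (ht : 0 < mu s.w) (hx : ∀ i, 0 < s.w.x i) (hz : ∀ i, 0 < s.w.z i) :
    ∃! d : Triple n m, S.IsNewtonDirection s σ d := by
  have hbij := newtonMap_bijective (P := S.P) ht hx hz
  set r : (Fin n → ℝ) × (Fin m → ℝ) × (Fin n → ℝ) :=
    (-(-(S.P.c + (σ * mu s.w / S.mu0) • S.cbar) - S.P.Q *ᵥ s.w.x + S.P.Aᵀ *ᵥ s.w.y + s.w.z
        - (σ * mu s.w) • (s.w.x - s.zeta)),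
      -(S.P.A *ᵥ s.w.x + (σ * mu s.w) • (s.w.y - s.lam)
        - (S.P.b + (σ * mu s.w / S.mu0) • S.bbar)),
      fun i => -(s.w.x i * s.w.z i - σ * mu s.w)) with hr
  have hiff : ∀ d : Triple n m,
      S.IsNewtonDirection s σ d ↔ newtonMap S.P s.w (mu s.w) (d.x, d.y, d.z) = r := by
    intro d
    simp only [IsNewtonDirection, newtonMap, LinearMap.coe_mk, AddHom.coe_mk, hr, Prod.mk.injEq,
      funext_iff (f := s.w.z * d.x + s.w.x * d.z), Pi.add_apply, Pi.mul_apply]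
  obtain ⟨d, hd⟩ := hbij.2 r
  refine ⟨⟨d.1, d.2.1, d.2.2⟩, (hiff _).2 hd, fun d' hd' => ?_⟩
  have := hbij.1 (((hiff d').1 hd').trans hd.symm)
  obtain ⟨a, b, c⟩ := d'
  rw [← this]

end Setup

end IPPMM

namespace IPPMM

variable {n m : ℕ}

theorem convergesQLinearly_zero {q : ℝ} (hq0 : 0 < q) (hq1 : q < 1) {u : ℕ → ℝ}
    (hu : ∀ k, 0 ≤ u k) (h : ∀ k, u (k + 1) ≤ q * u k) : ConvergesQLinearly q u 0 := by
  refine ⟨hq0, hq1, ?_, fun k => ?_⟩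
  · have h1 : ∀ k, u k ≤ q ^ k * u 0 := by
      intro k
      induction k with
      | zero => simp
      | succ k ih =>
        refine (h k).trans ((mul_le_mul_of_nonneg_left ih hq0.le).trans_eq ?_)
        ring
    refine squeeze_zero hu h1 ?_
    simpa using (tendsto_pow_atTop_nhds_zero_of_lt_one hq0.le hq1).mul_const (u 0)
  · rw [sub_zero, sub_zero, abs_of_nonneg (hu _), abs_of_nonneg (hu _)]
    exact h k

theorem eventually_mul_le (P : ℝ) {Q : ℝ} (hQ : 0 < Q) : ∀ᶠ a in 𝓝[>] (0 : ℝ), a * P ≤ Q := by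
  have h : Tendsto (fun a : ℝ => a * P) (𝓝[>] 0) (𝓝 (0 * P)) :=
    (tendsto_id.mul_const P).mono_left nhdsWithin_le_nhds
  rw [zero_mul] at h
  exact (h.eventually (gt_mem_nhds hQ)).mono fun _ => le_of_lt

theorem QP.Bounded.continuous_seminormA {P : QP n m} {K : ℝ} (hP : P.Bounded K) :
    Continuous fun p : (Fin m → ℝ) × (Fin n → ℝ) => P.seminormA p.1 p.2 := by
  have hK := hP.nonneg
  have h0 : 0 ≤ 2 * n * (1 + K + K * K) := by positivity
  refine (LipschitzWith.of_le_add_mul (⟨2 * n * (1 + K + K * K), h0⟩ : NNReal)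
    fun p r => ?_).continuous
  have h1 := hP.seminormA_add_le r.1 (p.1 - r.1) r.2 (p.2 - r.2)
  rw [add_sub_cancel, add_sub_cancel] at h1
  refine h1.trans (add_le_add_right (hP.seminormA_le_of_norm_le ?_ ?_) _)
  · rw [dist_eq_norm]; exact norm_fst_le (p - r)
  · rw [dist_eq_norm]; exact norm_snd_le (p - r)

theorem continuous_move (w d : Triple n m) :
    Continuous (fun α : ℝ => (w.move α d).x) ∧ Continuous (fun α : ℝ => (w.move α d).y) ∧
      Continuous (fun α : ℝ => (w.move α d).z) := by
  unfold Triple.move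
  refine ⟨?_, ?_, ?_⟩ <;> fun_prop

theorem continuous_mu_move (w d : Triple n m) : Continuous fun α : ℝ => mu (w.move α d) := by
  obtain ⟨hx, -, hz⟩ := continuous_move w d
  unfold mu
  exact (hx.dotProduct hz).div_const _

namespace Setup

variable {par : Params} {rho K : ℝ}

theorem IsNewtonDirection.mu_move (hn : 0 < n) {S : Setup n m} {s : State n m} {σ : ℝ}
    {d : Triple n m} (h : S.IsNewtonDirection s σ d) (α : ℝ) :
    mu (s.w.move α d) = mu s.w - α * (1 - σ) * mu s.w + α ^ 2 * (d.x ⬝ᵥ d.z / n) := by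
  have hn' : (n : ℝ) ≠ 0 := (Nat.cast_pos.2 hn).ne'
  have h1 : s.w.x ⬝ᵥ d.z + d.x ⬝ᵥ s.w.z = n * (σ * mu s.w) - n * mu s.w := by
    rw [← dotProduct_eq_mul_mu hn s.w]
    simp only [dotProduct]
    rw [← Finset.sum_add_distrib]
    have h2 : ∀ i, s.w.x i * d.z i + d.x i * s.w.z i = σ * mu s.w - s.w.x i * s.w.z i := by
      intro i
      linarith [h.2.2 i]
    simp only [h2, Finset.sum_sub_distrib, Finset.sum_const, Finset.card_univ, Fintype.card_fin,
      nsmul_eq_mul]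
  have h3 : (s.w.move α d).x ⬝ᵥ (s.w.move α d).z = s.w.x ⬝ᵥ s.w.z +
      α * (s.w.x ⬝ᵥ d.z + d.x ⬝ᵥ s.w.z) + α ^ 2 * (d.x ⬝ᵥ d.z) := by
    simp only [Triple.move, dotProduct_add, add_dotProduct, dotProduct_smul, smul_dotProduct,
      smul_eq_mul]
    ring
  rw [mu, h3, h1, dotProduct_eq_mul_mu hn]
  field_simp
  ring

/-- Some positive step-length is admissible at all states and for all instances. -/
theorem exists_admissible_step (hn : 0 < n) (par : Params) (hrho : 0 < rho) (K L : ℝ) :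
    ∃ a, 0 < a ∧ a ≤ 1 ∧ ∀ S : Setup n m, S.Bounded par rho K → ∀ s, S.Invariant L s →
      ∀ σ ∈ Set.Icc par.sigmaMin par.sigmaMax, ∀ d, S.IsNewtonDirection s σ d →
      a ∈ S.admissibleSteps s d := by
  obtain ⟨C, hC, HC⟩ := exists_newton_bound (m := m) hn par hrho K L
  obtain ⟨G, hG, HG⟩ := exists_drift_bound (m := m) hn par hrho K L
  have hn1 : (1 : ℝ) ≤ n := by exact_mod_cast hn
  set E := C ^ 2 * n with hE
  have hE0 : 0 ≤ E := by positivity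
  set F := E * G + (1 + E) * C with hF
  have hF0 : 0 ≤ F := by positivity
  set N := 2 * n * (1 + K + K * K) with hN
  have hσm := par.sigmaMin_pos
  have hCN := par.CN_pos
  have hγA := par.gammaA_pos
  have hγ0 := par.gammaMu_pos
  have hγ1 : 0 < 1 - par.gammaMu := by linarith [par.gammaMu_lt]
  obtain ⟨a, ha0, ha1, haE, haC, hac, har, has⟩ := ((eventually_mem_nhdsWithin (a := (0 : ℝ))
    (s := Set.Ioi 0)).and
    ((eventually_mul_le 1 one_pos).and ((eventually_mul_le E (show (0 : ℝ) < 0.49 by norm_num)).and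
    ((eventually_mul_le C (show (0 : ℝ) < 1 / 2 by norm_num)).and
    ((eventually_mul_le (2 * E) (show 0 < par.sigmaMin * (1 - par.gammaMu) by positivity)).and
    ((eventually_mul_le ((m + n) * F * rho ^ 2 + par.CN * E)
      (show 0 < par.CN * par.sigmaMin by positivity)).and
    (eventually_mul_le (N * F * rho ^ 2 + par.gammaA * rho * E)
      (show 0 < par.gammaA * rho * par.sigmaMin by positivity)))))))).exists
  rw [Set.mem_Ioi] at ha0
  rw [mul_one] at ha1
  refine ⟨a, ha0, ha1, fun S hS s hs σ ⟨hσ, hσ'⟩ d hd => ?_⟩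
  have hσ2 : σ ≤ 1 / 2 := hσ'.trans par.sigmaMax_le
  obtain ⟨hdx, hdz, hdxn, hdyn⟩ := HC S hS s hs σ d (hσm.le.trans hσ) (by linarith) hd
  obtain ⟨hg1, hg2⟩ := HG S hS s hs
  have hmu0 : S.mu0 = rho ^ 2 := by rw [mu0_eq hn, hS.rho_eq]
  have hmupos : 0 < S.mu0 := by rw [hmu0]; positivity
  have ht := mu_pos hn hs.x_pos hs.z_pos
  set t := mu s.w with ht_def
  have hprod : ∀ i, |d.x i * d.z i| ≤ C ^ 2 * (s.w.x i * s.w.z i) := fun i => by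
    rw [abs_mul]
    refine (mul_le_mul (hdx i) (hdz i) (abs_nonneg _)
      (mul_nonneg hC (hs.x_pos i).le)).trans_eq (by ring)
  have hprodE : ∀ i, |d.x i * d.z i| ≤ E * t := fun i => by
    refine (hprod i).trans ?_
    rw [hE, mul_assoc]
    exact mul_le_mul_of_nonneg_left (mul_le_mul_mu hn hs.x_pos hs.z_pos i) (sq_nonneg C)
  set κ := d.x ⬝ᵥ d.z / n with hκ
  have hκE : |κ| ≤ E * t := by
    have h1 : |d.x ⬝ᵥ d.z| ≤ n * (E * t) :=
      (Finset.abs_sum_le_sum_abs _ _).trans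
        ((Finset.sum_le_card_nsmul _ _ _ fun i _ => hprodE i).trans (by simp))
    rw [hκ, abs_div, Nat.abs_cast, div_le_iff₀ (by linarith)]
    linarith
  obtain ⟨hκ1, hκ2⟩ := abs_le.1 hκE
  have ht' := hd.mu_move hn a
  rw [← hκ, ← ht_def] at ht'
  set t' := mu (s.w.move a d) with ht'_def
  have hlow : t * (1 - a + a * σ - a ^ 2 * E) ≤ t' := by
    have := mul_le_mul_of_nonneg_left hκ1 (sq_nonneg a)
    rw [ht']
    linarith
  have hup : t' ≤ t * (1 - a + a * σ + a ^ 2 * E) := by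
    have := mul_le_mul_of_nonneg_left hκ2 (sq_nonneg a)
    rw [ht']
    linarith
  have hat : 0 < a * t := mul_pos ha0 ht
  have hmovex : ∀ i, 0 < (s.w.move a d).x i := fun i => by
    have h1 : (s.w.move a d).x i = s.w.x i + a * d.x i := rfl
    have h2 := mul_le_mul_of_nonneg_left ((neg_abs_le (d.x i)).trans' (neg_le_neg (hdx i))) ha0.le
    have h3 := mul_le_mul_of_nonneg_right haC (hs.x_pos i).le
    rw [h1]
    linarith [hs.x_pos i]
  have hmovez : ∀ i, 0 < (s.w.move a d).z i := fun i => by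
    have h1 : (s.w.move a d).z i = s.w.z i + a * d.z i := rfl
    have h2 := mul_le_mul_of_nonneg_left ((neg_abs_le (d.z i)).trans' (neg_le_neg (hdz i))) ha0.le
    have h3 := mul_le_mul_of_nonneg_right haC (hs.z_pos i).le
    rw [h1]
    linarith [hs.z_pos i]
  have ht'0 : 0 < t' := mu_pos hn hmovex hmovez
  refine ⟨ha0, ha1, ?_, ?_, hmovex, hmovez, fun i => ?_⟩
  · refine hup.trans ?_
    rw [mul_comm]
    refine mul_le_mul_of_nonneg_right ?_ ht.le
    have h1 := mul_le_mul_of_nonneg_left haE ha0.le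
    have h2 := mul_le_mul_of_nonneg_left hσ2 ha0.le
    linarith
  · rw [mem_enlargedSet_iff hS.P ht'0 hmupos]
    have hdelta : t' - t + a * (1 - σ) * t = a ^ 2 * κ := by rw [ht']; ring
    have hdiff : |a * (t' - t)| ≤ a ^ 2 * t * (1 + E) := by
      rw [abs_mul, abs_of_pos ha0]
      have h1 : |t' - t| ≤ a * t * (1 + E) := by
        have h2 := mul_le_mul_of_nonneg_left hσ hat.le
        have h3 := mul_le_mul_of_nonneg_left hσ2 hat.le
        have h4 : a * a * (t * E) ≤ a * 1 * (t * E) := by gcongr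
        have h5 : 0 < a * t * par.sigmaMin := mul_pos hat hσm
        rw [abs_le]
        constructor <;> linarith
      exact (mul_le_mul_of_nonneg_left h1 ha0.le).trans_eq (by ring)
    have herr : ∀ {k : ℕ} (g e : Fin k → ℝ) (r : ℝ), ‖g‖ ≤ G → ‖e‖ ≤ C → |r| = |a * (t' - t)| →
        ‖(a ^ 2 * κ) • g + r • e‖ ≤ a ^ 2 * t * F := by
      intro k g e r hg he hr
      have h1 : ‖(a ^ 2 * κ) • g‖ ≤ a ^ 2 * (E * t) * G := by
        rw [norm_smul, Real.norm_eq_abs, abs_mul, abs_of_nonneg (sq_nonneg a)]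
        gcongr
      have h2 : ‖r • e‖ ≤ a ^ 2 * t * (1 + E) * C := by
        rw [norm_smul, Real.norm_eq_abs, hr]
        gcongr
      refine (norm_add_le _ _).trans ((add_le_add h1 h2).trans_eq ?_)
      rw [hF]; ring
    obtain ⟨hr1, hr2⟩ := hs.residual
    rw [hS.par_eq, ← ht_def] at hr1
    rw [hS.par_eq, hS.rho_eq, ← ht_def] at hr2
    have hep := herr (S.primalDrift s) d.y (a * (t' - t)) hg1 hdyn rfl
    have hed := herr (S.dualDrift s) d.x (-(a * (t' - t))) hg2 hdxn (abs_neg _)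
    have h1a : 0 ≤ 1 - a := by linarith
    rw [ResidualBound, hd.primalResidual_move, hd.dualResidual_move, ← ht_def, hdelta, hS.par_eq,
      hS.rho_eq]
    have hfinal : ∀ c D : ℝ, 0 < c → a * (D * F * rho ^ 2 + c * E) ≤ c * par.sigmaMin →
        (1 - a) * (c * (t / S.mu0)) + D * (a ^ 2 * t * F) ≤ c * (t' / S.mu0) := by
      intro c D hc hcD
      have h1 : (1 - a) * (c * (t / S.mu0)) + D * (a ^ 2 * t * F) =
          ((1 - a) * (c * t) + D * (a ^ 2 * t * F) * rho ^ 2) / S.mu0 := by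
        rw [hmu0]
        have := hrho.ne'
        field_simp
      have h2 : c * (t' / S.mu0) = c * t' / S.mu0 := by ring
      rw [h1, h2, div_le_div_iff_of_pos_right hmupos]
      have h3 := mul_le_mul_of_nonneg_left hlow hc.le
      have h4 := mul_le_mul_of_nonneg_left hcD hat.le
      have h5 := mul_le_mul_of_nonneg_left hσ (mul_pos hat hc).le
      linarith
    constructor
    · refine (pairNorm2_add_le _ _ _ _).trans ?_
      rw [pairNorm2_smul, abs_of_nonneg h1a]
      refine (add_le_add (mul_le_mul_of_nonneg_left hr1 h1a)
        (pairNorm2_le (by positivity) hep hed)).trans ?_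
      rw [Fintype.card_fin, Fintype.card_fin]
      exact hfinal par.CN (m + n) hCN har
    · refine (hS.P.seminormA_add_le _ _ _ _).trans ?_
      refine (add_le_add ((hS.P.seminormA_smul_le h1a _ _).trans
        (mul_le_mul_of_nonneg_left hr2 h1a))
        (hS.P.seminormA_le_of_norm_le hep hed)).trans ?_
      exact hfinal (par.gammaA * rho) N (by positivity) has
  · have h1 : (s.w.move a d).x i * (s.w.move a d).z i =
        (1 - a) * (s.w.x i * s.w.z i) + a * (σ * t) + a ^ 2 * (d.x i * d.z i) := by
      have h2 : s.w.z i * d.x i = σ * t - s.w.x i * s.w.z i - s.w.x i * d.z i := by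
        linarith [hd.2.2 i]
      have h3 : (s.w.move a d).x i * (s.w.move a d).z i = s.w.x i * s.w.z i +
          a * (s.w.z i * d.x i + s.w.x i * d.z i) + a ^ 2 * (d.x i * d.z i) := by
        simp only [Triple.move, Pi.add_apply, Pi.smul_apply, smul_eq_mul]
        ring
      rw [h3, h2]; ring
    have hcen := hs.central i
    rw [hS.par_eq, ← ht_def] at hcen
    rw [hS.par_eq, h1]
    have h4 := mul_le_mul_of_nonneg_left hcen (show 0 ≤ 1 - a by linarith)
    have h5 := mul_le_mul_of_nonneg_left (neg_le_of_abs_le (hprodE i)) (sq_nonneg a)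
    have h6 := mul_le_mul_of_nonneg_left hup hγ0.le
    have h7 := mul_le_mul_of_nonneg_left hac hat.le
    have h8 := mul_le_mul_of_nonneg_left hσ (mul_pos hat hγ1).le
    have h9 : par.gammaMu * (a ^ 2 * t * E) ≤ 1 * (a ^ 2 * t * E) :=
      mul_le_mul_of_nonneg_right par.gammaMu_lt.le (by positivity)
    linarith

/-- The supremum of the admissible step-lengths is either attained or leads to an optimal
triple. -/
theorem isGreatest_or_isOptimalTriple (hn : 0 < n) {S : Setup n m} (hP : S.P.Bounded K)
    (hmu0 : 0 < S.mu0) {s : State n m} {d : Triple n m} {a : ℝ}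
    (ha : a ∈ S.admissibleSteps s d) :
    (∃ α, IsGreatest (S.admissibleSteps s d) α) ∨
      ∃ α ∈ Set.Ioc (0 : ℝ) 1, S.P.IsOptimalTriple (s.w.move α d) := by
  obtain ⟨hx, hy, hz⟩ := continuous_move s.w d
  have hmu := continuous_mu_move s.w d
  have hbdd : BddAbove (S.admissibleSteps s d) := ⟨1, fun α h => h.2.1⟩
  set b := sSup (S.admissibleSteps s d) with hb
  have hb0 : 0 < b := ha.1.trans_le (le_csSup hbdd ha)
  have hb1 : b ≤ 1 := csSup_le ⟨a, ha⟩ fun α h => h.2.1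
  have hprim : Continuous fun α : ℝ =>
      S.primalResidual (mu (s.w.move α d)) s.lam (s.w.move α d) := by
    unfold primalResidual
    have h1 : Continuous fun α : ℝ => S.P.A *ᵥ (s.w.move α d).x := continuous_const.matrix_mulVec hx
    fun_prop
  have hdual : Continuous fun α : ℝ =>
      S.dualResidual (mu (s.w.move α d)) s.zeta (s.w.move α d) := by
    unfold dualResidual
    have h1 : Continuous fun α : ℝ => S.P.Q *ᵥ (s.w.move α d).x := continuous_const.matrix_mulVec hx
    have h2 : Continuous fun α : ℝ => S.P.Aᵀ *ᵥ (s.w.move α d).y :=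
      continuous_const.matrix_mulVec hy
    fun_prop
  have hxi : ∀ i, Continuous fun α : ℝ => (s.w.move α d).x i := fun i =>
    (continuous_apply i).comp hx
  have hzi : ∀ i, Continuous fun α : ℝ => (s.w.move α d).z i := fun i =>
    (continuous_apply i).comp hz
  have hmem := csSup_mem_closure ⟨a, ha⟩ hbdd
  rw [← hb] at hmem
  have hdec : mu (s.w.move b d) ≤ (1 - 0.01 * b) * mu s.w :=
    closure_minimal (t := {α | mu (s.w.move α d) ≤ (1 - 0.01 * α) * mu s.w})
      (fun α h => h.2.2.1) (isClosed_le hmu (by fun_prop)) hmem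
  have hx0 : ∀ i, 0 ≤ (s.w.move b d).x i := fun i =>
    closure_minimal (fun α h => (h.2.2.2.2.1 i).le) (isClosed_le continuous_const (hxi i)) hmem
  have hz0 : ∀ i, 0 ≤ (s.w.move b d).z i := fun i =>
    closure_minimal (fun α h => (h.2.2.2.2.2.1 i).le) (isClosed_le continuous_const (hzi i)) hmem
  have hcen : ∀ i, S.par.gammaMu * mu (s.w.move b d) ≤ (s.w.move b d).x i * (s.w.move b d).z i :=
    fun i => closure_minimal (fun α h => h.2.2.2.2.2.2 i)
      (isClosed_le (continuous_const.mul hmu) ((hxi i).mul (hzi i))) hmem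
  have hA : ∀ α ∈ S.admissibleSteps s d,
      S.ResidualBound (mu (s.w.move α d)) s.zeta s.lam (s.w.move α d) := fun α h =>
    (mem_enlargedSet_iff hP (mu_pos hn h.2.2.2.2.1 h.2.2.2.2.2.1) hmu0).1 h.2.2.2.1
  have hres : S.ResidualBound (mu (s.w.move b d)) s.zeta s.lam (s.w.move b d) :=
    ⟨closure_minimal (fun α h => (hA α h).1) (isClosed_le
      (continuous_pairNorm2.comp (hprim.prodMk hdual)) (by fun_prop)) hmem,
    closure_minimal (fun α h => (hA α h).2) (isClosed_le
      (hP.continuous_seminormA.comp (hprim.prodMk hdual)) (by fun_prop)) hmem⟩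
  have hdot0 : 0 ≤ (s.w.move b d).x ⬝ᵥ (s.w.move b d).z :=
    Finset.sum_nonneg fun i _ => mul_nonneg (hx0 i) (hz0 i)
  have hmub : 0 ≤ mu (s.w.move b d) := div_nonneg hdot0 (Nat.cast_nonneg n)
  rcases hmub.eq_or_lt with h0 | h0
  · right
    refine ⟨b, ⟨hb0, hb1⟩, ?_⟩
    have hpair : pairNorm2 (S.primalResidual 0 s.lam (s.w.move b d))
        (S.dualResidual 0 s.zeta (s.w.move b d)) ≤ 0 := by
      have := hres.1
      rwa [← h0, zero_div, mul_zero] at this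
    have h1 := norm_le_zero_iff.1 ((norm_left_le_pairNorm2 _ _).trans hpair)
    have h2 := norm_le_zero_iff.1 ((norm_right_le_pairNorm2 _ _).trans hpair)
    simp only [primalResidual, dualResidual, zero_smul, zero_div, add_zero, sub_zero] at h1 h2
    refine ⟨?_, h1, fun i => ?_, hx0, hz0⟩
    · rw [← neg_eq_zero, ← h2]; abel
    · have h3 : (s.w.move b d).x ⬝ᵥ (s.w.move b d).z = 0 := by
        rw [dotProduct_eq_mul_mu hn, ← h0, mul_zero]
      exact (Finset.sum_eq_zero_iff_of_nonneg fun i _ => mul_nonneg (hx0 i) (hz0 i)).1 h3 i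
        (Finset.mem_univ i)
  · left
    have hprod : ∀ i, 0 < (s.w.move b d).x i * (s.w.move b d).z i := fun i =>
      (mul_pos S.par.gammaMu_pos h0).trans_le (hcen i)
    refine ⟨b, ⟨hb0, hb1, hdec, (mem_enlargedSet_iff hP h0 hmu0).2 hres, fun i => ?_, fun i => ?_,
      hcen⟩, fun α h => le_csSup hbdd h⟩
    · exact pos_of_mul_pos_left (hprod i) (hz0 i)
    · exact pos_of_mul_pos_right (hprod i) (hx0 i)

theorem Invariant.mu_pos (hn : 0 < n) {S : Setup n m} {L : ℝ} {s : State n m}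
    (hs : S.Invariant L s) : 0 < mu s.w :=
  Setup.mu_pos hn hs.x_pos hs.z_pos

theorem Bounded.start_invariant (hn : 0 < n) (hrho : 0 < rho) {S : Setup n m}
    (hS : S.Bounded par rho K) {L : ℝ} (hL : rho ≤ L) (hKL : K ≤ L) : S.Invariant L S.start := by
  have hmu0 : S.mu0 = rho ^ 2 := by rw [mu0_eq hn, hS.rho_eq]
  have hpos : 0 < S.mu0 := by rw [hmu0]; positivity
  have hmu : mu S.start.w = S.mu0 := rfl
  have hp : S.primalResidual S.mu0 S.start.lam S.start.w = 0 := by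
    rw [primalResidual, div_self hpos.ne']
    simp [start, bbar]
  have hd : S.dualResidual S.mu0 S.start.zeta S.start.w = 0 := by
    rw [dualResidual, div_self hpos.ne']
    simp [start, cbar]
  have hxr : ∀ i, S.start.w.x i = rho := fun i => hS.rho_eq
  have hzr : ∀ i, S.start.w.z i = rho := fun i => hS.rho_eq
  have hpair : pairNorm2 (0 : Fin m → ℝ) (0 : Fin n → ℝ) ≤ 0 := by
    simpa using pairNorm2_le (u := (0 : Fin m → ℝ)) (v := (0 : Fin n → ℝ)) le_rfl
      norm_zero.le norm_zero.le
  have hsemi : S.P.seminormA 0 0 ≤ 0 := by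
    simpa using hS.P.seminormA_le_of_norm_le (b := 0) (c := 0) norm_zero.le norm_zero.le
  refine ⟨fun i => ?_, fun i => ?_, fun i => ?_, hmu.le, ?_, ?_, hS.y0_le.trans hKL⟩
  · rw [hxr]; exact hrho
  · rw [hzr]; exact hrho
  · rw [hmu, hmu0, hxr, hzr]
    nlinarith [S.par.gammaMu_lt, sq_nonneg rho]
  · rw [hmu, ResidualBound, hp, hd, div_self hpos.ne']
    refine ⟨hpair.trans ?_, hsemi.trans ?_⟩
    · linarith [S.par.CN_pos]
    · have := S.par.gammaA_pos
      rw [hS.rho_eq]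
      positivity
  · exact (S.norm_w0_x_le (hS.rho_eq ▸ hrho.le)).trans (hS.rho_eq ▸ hL)

theorem Invariant.step (hn : 0 < n) {S : Setup n m} (hP : S.P.Bounded K) (hmu0 : 0 < S.mu0)
    {L : ℝ} (hL : ∀ w : Triple n m, (∀ i, 0 < w.x i) → (∀ i, 0 < w.z i) → mu w ≤ S.mu0 →
      S.ResidualBound (mu w) w.x w.y w → ‖w.x‖ ≤ L ∧ ‖w.y‖ ≤ L)
    {s s' : State n m} (hs : S.Invariant L s) (h : S.Step s s') : S.Invariant L s' := by
  obtain ⟨σ, -, d, -, α, ⟨⟨hα0, hα1, hdec, hmem, hx, hz, hc⟩, -⟩, hw, hcase⟩ := h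
  rw [← hw] at hdec hmem hx hz hc
  have hle : mu s'.w ≤ S.mu0 := by
    refine (hdec.trans ?_).trans hs.mu_le
    exact mul_le_of_le_one_left (hs.mu_pos hn).le (by linarith)
  rcases hcase with ⟨htest, hζ, hlam⟩ | ⟨-, hζ, hlam⟩
  · have hres := updateTest_iff.1 htest
    obtain ⟨h1, h2⟩ := hL s'.w hx hz hle hres
    refine ⟨hx, hz, hc, hle, ?_, ?_, ?_⟩
    · rwa [hζ, hlam]
    · rwa [hζ]
    · rwa [hlam]
  · refine ⟨hx, hz, hc, hle, ?_, ?_, ?_⟩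
    · rw [hζ, hlam]
      exact (mem_enlargedSet_iff hP (Setup.mu_pos hn hx hz) hmu0).1 hmem
    · rw [hζ]; exact hs.zeta_le
    · rw [hlam]; exact hs.lam_le

/-- The states of all instances with bounded data satisfy the invariant with one constant. -/
theorem exists_invariant_of_reachable (hn : 0 < n) (par : Params) (hrho : 0 < rho) (K : ℝ) :
    ∃ L, ∀ S : Setup n m, S.Bounded par rho K → ∀ s, S.Reachable s → S.Invariant L s := by
  obtain ⟨C, hC, H⟩ := exists_updated_bound (m := m) hn par hrho K
  have hK := le_abs_self K
  have hK0 := abs_nonneg K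
  refine ⟨C + rho + |K|, fun S hS s hs => ?_⟩
  have hmu0 : 0 < S.mu0 := by rw [mu0_eq hn, hS.rho_eq]; positivity
  induction hs with
  | refl => exact hS.start_invariant hn hrho (by linarith) (by linarith)
  | tail _ hstep ih =>
    refine ih.step hn hS.P hmu0 (fun w hx hz hmu hres => ?_) hstep
    obtain ⟨h1, h2⟩ := H S hS w hx hz hmu hres
    exact ⟨by linarith, by linarith⟩

theorem IsRun.reachable {S : Setup n m} {s : ℕ → State n m} (h : S.IsRun s) (k : ℕ) :
    S.Reachable (s k) := by
  induction k with
  | zero => rw [h.1]; exact Relation.ReflTransGen.refl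
  | succ k ih => exact ih.tail (h.2 k)

end Setup

end IPPMM

theorem theorem1 (n m : ℕ) (hm : 0 < m) (hmn : m ≤ n)
    (Cstar CA1 CA2 CQ Cr Cy rho : ℝ)
    (hCstar : 0 ≤ Cstar) (hCA1 : 0 < CA1) (hCA2 : 0 < CA2) (hCQ : 0 < CQ) (hCr : 0 < Cr)
    (hCy : 0 ≤ Cy) (hrho : 0 < rho) (par : IPPMM.Params) :
    ∃ q : ℝ, 0 < q ∧ q < 1 ∧
      ∀ S : IPPMM.Setup n m, S.par = par → S.rho = rho → ‖S.y0‖ ≤ Cy →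
        S.P.Assumption1 Cstar → S.P.Assumption2 CA1 CA2 CQ Cr →
        (∀ s : IPPMM.State n m, S.Reachable s →
          ∀ σ ∈ Set.Icc par.sigmaMin par.sigmaMax,
            (∃! d : IPPMM.Triple n m, S.IsNewtonDirection s σ d) ∧
            ∀ d : IPPMM.Triple n m, S.IsNewtonDirection s σ d →
              (∃ α, IsGreatest (S.admissibleSteps s d) α) ∨
                ∃ α ∈ Set.Ioc (0 : ℝ) 1, S.P.IsOptimalTriple (s.w.move α d)) ∧
        ∀ s : ℕ → IPPMM.State n m, S.IsRun s →
          IPPMM.ConvergesQLinearly q (fun k => IPPMM.mu (s k).w) 0 ∧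
          IPPMM.ConvergesRLinearly q
            (fun k => IPPMM.norm2 (S.primalResidual (IPPMM.mu (s k).w) (s k).lam (s k).w)) 0 ∧
          IPPMM.ConvergesRLinearly q
            (fun k => IPPMM.norm2 (S.dualResidual (IPPMM.mu (s k).w) (s k).zeta (s k).w)) 0 := by

  have hn : 0 < n := hm.trans_le hmn
  obtain ⟨K₀, hK₀⟩ := IPPMM.QP.exists_bounded (Cstar := Cstar) hmn Cr hCA1 hCA2.le hCQ.le
  obtain ⟨K, hK⟩ : ∃ K, ∀ S : IPPMM.Setup n m, S.par = par → S.rho = rho → ‖S.y0‖ ≤ Cy →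
      S.P.Assumption1 Cstar → S.P.Assumption2 CA1 CA2 CQ Cr → S.Bounded par rho K :=
    ⟨K₀ + Cy, fun S h1 h2 h3 h4 h5 =>
      ⟨(hK₀ S.P h4 h5).mono (le_add_of_nonneg_right hCy), h1, h2,
        h3.trans (le_add_of_nonneg_left (hK₀ S.P h4 h5).nonneg)⟩⟩
  obtain ⟨L, hL⟩ := IPPMM.Setup.exists_invariant_of_reachable (m := m) hn par hrho K
  obtain ⟨a, ha0, ha1, hstep⟩ := IPPMM.Setup.exists_admissible_step (m := m) hn par hrho K L
  have hq0 : 0 < 1 - 0.01 * a := by linarith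
  have hq1 : 1 - 0.01 * a < 1 := by linarith
  refine ⟨1 - 0.01 * a, hq0, hq1, fun S hpar hSrho hy0 hA1 hA2 => ?_⟩
  have hS := hK S hpar hSrho hy0 hA1 hA2
  have hmu0 : 0 < S.mu0 := by rw [IPPMM.Setup.mu0_eq hn, hSrho]; positivity
  constructor
  · intro s hs σ hσ
    have hinv := hL S hS s hs
    exact ⟨S.existsUnique_isNewtonDirection σ (hinv.mu_pos hn) hinv.x_pos hinv.z_pos,
      fun d hd => IPPMM.Setup.isGreatest_or_isOptimalTriple hn hS.P hmu0
        (hstep S hS s hinv σ hσ d hd)⟩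
  · intro s hrun
    have hinv := fun k => hL S hS (s k) (hrun.reachable k)
    have hpos := fun k => (hinv k).mu_pos hn
    have hdec : ∀ k, IPPMM.mu (s (k + 1)).w ≤ (1 - 0.01 * a) * IPPMM.mu (s k).w := by
      intro k
      obtain ⟨σ, hσ, d, hd, α, ⟨hα, hmax⟩, hw, -⟩ := hrun.2 k
      have haα : a ≤ α := hmax (hstep S hS (s k) (hinv k) σ (hpar ▸ hσ) d hd)
      rw [hw]
      exact hα.2.2.1.trans (mul_le_mul_of_nonneg_right (by linarith) (hpos k).le)
    have hconv := IPPMM.convergesQLinearly_zero hq0 hq1 (fun k => (hpos k).le) hdec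
    have hCN : 0 ≤ S.par.CN / S.mu0 := div_nonneg S.par.CN_pos.le hmu0.le
    have hconv' := IPPMM.convergesQLinearly_zero hq0 hq1
      (u := fun k => S.par.CN / S.mu0 * IPPMM.mu (s k).w) (fun k => mul_nonneg hCN (hpos k).le)
      (fun k => (mul_le_mul_of_nonneg_left (hdec k) hCN).trans_eq (by ring))
    have hbound : ∀ k, S.par.CN * (IPPMM.mu (s k).w / S.mu0) =
        S.par.CN / S.mu0 * IPPMM.mu (s k).w := fun k => by ring
    refine ⟨hconv, ⟨_, hconv', fun k => ?_⟩, ⟨_, hconv', fun k => ?_⟩⟩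
    · rw [sub_zero, abs_of_nonneg (IPPMM.norm2_nonneg _), ← hbound]
      exact (IPPMM.norm2_le_pairNorm2_left _ _).trans (hinv k).residual.1
    · rw [sub_zero, abs_of_nonneg (IPPMM.norm2_nonneg _), ← hbound]
      exact (IPPMM.norm2_le_pairNorm2_right _ _).trans (hinv k).residual.1
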